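/- Let $1\le q\le 2$. For $\alpha\in\mathbb R$ and $u\in H_0^1(-1,1)$, $u\not\equiv 0$, put \[ \mathcal Q[u,\alpha]=\frac{\int_{-1}^{1}|u'|^{2}\,dx+\alpha\left|\int_{-1}^{1}|u|^{q-1}u\,dx\right|^{2/q}}{\int_{-1}^{1}|u|^{2}\,dx}, \qquad \lambda(\alpha,q)=\inf\left\{\mathcal Q[u,\alpha]\;:\;u\in H_0^1(-1,1),\ u\not\equiv 0\right\}. \] A minimizer of $\lambda(\alpha,q)$ is a function $y\in H_0^1(-1,1)$, $y\not\equiv0$, with $\mathcal Q[y,\alpha]=\lambda(\alpha,q)$. There exists a number $\alpha_q>0$ such that: 1. If $\alpha<\alpha_q$, then $\lambda(\alpha,q)<\pi^2$, and every minimizer $y$ of $\lambda(\alpha,q)$ has constant sign in $(-1,1)$, that is, its continuous representative is either positive at every point of $(-1,1)$ or negative at every point of $(-1,1)$. 2. If $\alpha\ge\alpha_q$, then $\lambda(\alpha,q)=\pi^2$. Moreover, if $\alpha>\alpha_q$, then the function $\sin\pi x$, $x\in[-1,1]$, is the only minimizer of $\lambda(\alpha,q)$ up to a multiplicative constant: the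 minimizers are exactly the functions $c\sin \pi x$ with $c\in\mathbb R\setminus\{0\}$. The function $y(x)=\sin\pi x$ is odd, satisfies $\int_{-1}^{1}|y(x)|^{q-1}y(x)\,dx=0$, and $\overline x=0$ is the only point of $(-1,1)$ with $y(\overline x)=0$. -/

import Mathlib

open MeasureTheory Set

open scoped ContDiff Interval

noncomputable section

namespace NonlocalEigenvalue

/-- Lebesgue measure on the open interval `(-1, 1)`. -/
def vol : Measure ℝ := volume.restrict (Ioo (-1 : ℝ) 1)

/-- Test functions: elements of `C_c^∞(-1, 1)`. -/
structure IsTestFunction (φ : ℝ → ℝ) : Prop where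
  smooth : ContDiff ℝ ∞ φ
  compact : HasCompactSupport φ
  support : tsupport φ ⊆ Ioo (-1 : ℝ) 1

/-- `u'` is a weak derivative of `u` on `(-1, 1)` (used for `u` and `u'` in `L²(-1, 1)`). -/
def HasWeakDeriv (u u' : ℝ → ℝ) : Prop :=
  ∀ φ : ℝ → ℝ, IsTestFunction φ →
    ∫ x in (-1 : ℝ)..1, u x * deriv φ x = -∫ x in (-1 : ℝ)..1, u' x * φ x

/-- `u` belongs to the Sobolev space `H¹₀(-1, 1)` and `u'` is its weak derivative: `u` and `u'` are
in `L²(-1, 1)`, and `u` is in the closure of `C_c^∞(-1, 1)` for the norm of `H¹(-1, 1)`.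
The functions are representatives of their classes modulo equality almost everywhere on `(-1, 1)`;
their values elsewhere play no role. -/
structure IsH10 (u u' : ℝ → ℝ) : Prop where
  memLp : MemLp u 2 vol
  memLp_deriv : MemLp u' 2 vol
  weakDeriv : HasWeakDeriv u u'
  closure : ∀ ε : ℝ, 0 < ε → ∃ φ : ℝ → ℝ, IsTestFunction φ ∧
    (∫ x in (-1 : ℝ)..1, (u x - φ x) ^ 2) + (∫ x in (-1 : ℝ)..1, (u' x - deriv φ x) ^ 2) < ε

/-- The pairs `(u, u')` with `u ∈ H¹₀(-1, 1)`, `u ≢ 0`, and `u'` the weak derivative of `u`. -/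
def Admissible (u u' : ℝ → ℝ) : Prop :=
  IsH10 u u' ∧ ¬ u =ᵐ[vol] 0

/-- The `q`-average `∫_{-1}^{1} |u|^{q-1} u dx`. -/
def qAverage (q : ℝ) (u : ℝ → ℝ) : ℝ :=
  ∫ x in (-1 : ℝ)..1, |u x| ^ (q - 1) * u x

/-- The quotient `𝒬[u, α]`, with `u'` the weak derivative of `u`. -/
def rayleigh (α q : ℝ) (u u' : ℝ → ℝ) : ℝ :=
  ((∫ x in (-1 : ℝ)..1, |u' x| ^ 2) + α * |qAverage q u| ^ (2 / q)) /
    ∫ x in (-1 : ℝ)..1, |u x| ^ 2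

/-- `λ(α, q)`, the infimum of `𝒬[u, α]` over `u ∈ H¹₀(-1, 1)`, `u ≢ 0`. -/
def lam (α q : ℝ) : ℝ :=
  sInf {r : ℝ | ∃ u u' : ℝ → ℝ, Admissible u u' ∧ r = rayleigh α q u u'}

/-- `y` is a minimizer of `𝒬[·, α]` among the nonzero elements of `H¹₀(-1, 1)`. -/
def IsMinimizer (α q : ℝ) (y : ℝ → ℝ) : Prop :=
  ∃ y' : ℝ → ℝ, Admissible y y' ∧
    ∀ u u' : ℝ → ℝ, Admissible u u' → rayleigh α q y y' ≤ rayleigh α q u u'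

/-- `y` has constant sign in `(-1, 1)`: its continuous representative is positive at every point of
`(-1, 1)`, or negative at every point of `(-1, 1)`. -/
def HasConstantSign (y : ℝ → ℝ) : Prop :=
  ∃ w : ℝ → ℝ, ContinuousOn w (Icc (-1 : ℝ) 1) ∧ y =ᵐ[vol] w ∧
    ((∀ x ∈ Ioo (-1 : ℝ) 1, 0 < w x) ∨ (∀ x ∈ Ioo (-1 : ℝ) 1, w x < 0))

end NonlocalEigenvalue

end

/-!
The quotient is affine and nondecreasing in `α`, and `sin (π x)`, whose `q`-average vanishes, always
gives it the value `π²`. Hence the set `saturated q` of those `α` for which the infimum is at least `π²`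
is a closed half-line, once it is known to be nonempty and bounded below by a positive number; the
threshold `αq` is its minimum. Comparison with `1 - x²` gives the lower bound. Everything else rests on
one fact (`IsMinimal.pi_sq_le`): a minimizer with an interior zero has level `μ ≥ π²`, and if `μ = π²`
and its `q`-average vanishes, it is a multiple of `sin (π x)`.

To prove it, a minimizer is first shown to be a classical solution of `y'' + μ y = κ |y| ^ (q - 1)` on
`[-1, 1]`, with a constant `κ` (`exists_solvesOn`). The elements of `H¹₀(-1, 1)` are the primitives of
the mean-zero functions in `L²(-1, 1)` (`IsH10.ae_eq_prim`, `isH10_prim`). Variations that fix the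
`q`-average to first order give the weak equation with a multiplier `κ`, and regularity follows by
testing with the mean-zero part of the defect itself.

Say `κ ≥ 0`. Next to a transversal interior zero there is a positive and a negative arc of the solution,
with the same slope, up to sign, at their ends, by conservation of energy. Each arc contains two disjoint quarter
arcs, from a zero to the nearest critical point. Let `w` be a positive quarter arc of length `T` and `z`
the absolute value of a negative one of length `t`, both issuing from `0`. The Wronskian `w' z - w z'` is
nondecreasing, which gives `t ≤ T` and `z ≤ w` on `[0, t]`. Placed back to back, the two arcs form a
monotone function on an interval of length `T + t`. Testing the equation against the cosine with half
period `T + t` shows that `(μ - (π / (T + t))²)` times a positive integral equals `κ` times a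
nonnegative integral (`QuarterArc.sq_le`). As the four quarter arcs fit into `[-1, 1]`, some such pair has
`T + t ≤ 1`, and `μ ≥ π²` follows. If `μ = π²`, the arcs fill `[-1, 1]`; the positive ones carry strictly
more `q`-mass unless `κ = 0`, so a vanishing `q`-average leaves the linear equation and the sine. At a
degenerate zero the energy is zero; then `y ≥ 0`, and the same test on a single quarter arc of length less
than `1` gives `μ > π²`.

That the saturated set is nonempty follows by contradiction: for a large `α`, a minimizer
(`exists_minimizer`) of level less than `π²` has no interior zero, hence constant sign, and for such
functions the `q`-average controls the `L²` norm (`integral_sq_le_of_sign`). For `α > αq` a minimizer has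
vanishing `q`-average, since otherwise a smaller saturated `α` would contradict its level `π²`.
-/

noncomputable section

namespace NonlocalEigenvalue

/-! ### The space `L²(-1, 1)` and primitives -/

section

instance isFiniteMeasure_vol : IsFiniteMeasure vol := by
  unfold vol; infer_instance

instance nullSingletonClass_vol : NullSingletonClass vol := by
  unfold vol; infer_instance

theorem integral_eq_integral_vol (f : ℝ → ℝ) : ∫ x in (-1 : ℝ)..1, f x = ∫ x, f x ∂vol := by
  rw [intervalIntegral.integral_of_le (by norm_num), vol, integral_Ioc_eq_integral_Ioo]

theorem vol_real_univ : vol.real univ = 2 := by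
  simp [vol, Measure.real]; norm_num

theorem integral_add_mul_sq {f g : ℝ → ℝ} (hf : MemLp f 2 vol) (hg : MemLp g 2 vol) (t : ℝ) :
    ∫ x, (f x + t * g x) ^ 2 ∂vol = (∫ x, f x ^ 2 ∂vol) + 2 * t * (∫ x, f x * g x ∂vol)
      + t ^ 2 * ∫ x, g x ^ 2 ∂vol := by
  have hff := hf.integrable_sq
  have hgg := hg.integrable_sq
  have hfg : Integrable (fun x => f x * g x) vol := hf.integrable_mul hg
  have h1 : ∀ x, (f x + t * g x) ^ 2 = f x ^ 2 + (2 * t * (f x * g x) + t ^ 2 * g x ^ 2) := by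
    intro x; ring
  simp_rw [h1]
  have h2 := integral_add hff ((hfg.const_mul (2 * t)).add (hgg.const_mul (t ^ 2)))
  have h3 := integral_add (hfg.const_mul (2 * t)) (hgg.const_mul (t ^ 2))
  simp only [Pi.add_apply] at h2
  rw [h2, h3, integral_const_mul, integral_const_mul]
  ring

/-- The Cauchy–Schwarz inequality. -/
theorem integral_mul_sq_le {f g : ℝ → ℝ} (hf : MemLp f 2 vol) (hg : MemLp g 2 vol) :
    (∫ x, f x * g x ∂vol) ^ 2 ≤ (∫ x, f x ^ 2 ∂vol) * ∫ x, g x ^ 2 ∂vol := by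
  have key : ∀ t : ℝ, 0 ≤ (∫ x, g x ^ 2 ∂vol) * (t * t) + (2 * ∫ x, f x * g x ∂vol) * t
      + ∫ x, f x ^ 2 ∂vol := by
    intro t
    have h : 0 ≤ ∫ x, (f x + t * g x) ^ 2 ∂vol := integral_nonneg fun x => sq_nonneg _
    rw [integral_add_mul_sq hf hg] at h
    linarith
  have := discrim_le_zero key
  unfold discrim at this
  nlinarith

theorem integral_add_sq_le {f g : ℝ → ℝ} (hf : MemLp f 2 vol) (hg : MemLp g 2 vol) :
    ∫ x, (f x + g x) ^ 2 ∂vol ≤ 2 * (∫ x, f x ^ 2 ∂vol) + 2 * ∫ x, g x ^ 2 ∂vol := by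
  have h1 := integral_add_mul_sq hf hg 1
  have h2 := integral_add_mul_sq hf hg (-1)
  have h : 0 ≤ ∫ x, (f x + -1 * g x) ^ 2 ∂vol := integral_nonneg fun x => sq_nonneg _
  simp only [one_mul] at h1
  linarith

theorem memLp_of_continuous {f : ℝ → ℝ} (hf : Continuous f) (p : ENNReal) : MemLp f p vol := by
  obtain ⟨C, hC⟩ := isCompact_Icc.exists_bound_of_continuousOn (s := Icc (-1 : ℝ) 1) hf.continuousOn
  refine MemLp.of_bound hf.aestronglyMeasurable C ?_
  unfold vol
  filter_upwards [ae_restrict_mem measurableSet_Ioo] with x hx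
  exact hC x (Ioo_subset_Icc_self hx)

theorem integrable_of_continuous {f : ℝ → ℝ} (hf : Continuous f) : Integrable f vol :=
  memLp_one_iff_integrable.1 (memLp_of_continuous hf 1)

theorem integrable_of_memLp {g : ℝ → ℝ} (hg : MemLp g 2 vol) : Integrable g vol :=
  hg.integrable (by norm_num)

/-- The primitive of `g` on `(-1, 1)` that vanishes at `-1`. Integrating against `vol` makes it a
function on the whole line, equal to `0` on the left and constant on the right of `(-1, 1)`. -/
def prim (g : ℝ → ℝ) (x : ℝ) : ℝ := ∫ t in Iic x, g t ∂vol

theorem prim_eq_intervalIntegral (g : ℝ → ℝ) {x : ℝ} (hx : x ∈ Icc (-1 : ℝ) 1) :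
    prim g x = ∫ t in (-1 : ℝ)..x, g t := by
  rw [prim, vol, Measure.restrict_restrict measurableSet_Iic, intervalIntegral.integral_of_le hx.1]
  apply setIntegral_congr_set
  have h1 : (Ioo (-1 : ℝ) x : Set ℝ) =ᵐ[volume] Ioc (-1 : ℝ) x := Ioo_ae_eq_Ioc
  have h2 : (Ioo (-1 : ℝ) x : Set ℝ) ⊆ Iic x ∩ Ioo (-1) 1 := fun t ht =>
    ⟨ht.2.le, ht.1, ht.2.trans_le hx.2⟩
  have h3 : Iic x ∩ Ioo (-1) 1 ⊆ Ioc (-1 : ℝ) x := fun t ht => ⟨ht.2.1, ht.1⟩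
  exact (h3.eventuallyLE).antisymm (h1.symm.le.trans h2.eventuallyLE)

theorem prim_neg_one (g : ℝ → ℝ) : prim g (-1) = 0 := by
  rw [prim_eq_intervalIntegral g (by simp)]; simp

theorem prim_one (g : ℝ → ℝ) : prim g 1 = ∫ x, g x ∂vol := by
  rw [prim_eq_intervalIntegral g (by simp), integral_eq_integral_vol]

theorem prim_congr {g h : ℝ → ℝ} (hgh : g =ᵐ[vol] h) : prim g = prim h := by
  funext x
  exact integral_congr_ae (ae_restrict_of_ae hgh)

theorem prim_add {g h : ℝ → ℝ} (hg : Integrable g vol) (hh : Integrable h vol) (x : ℝ) :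
    prim (fun t => g t + h t) x = prim g x + prim h x :=
  integral_add hg.integrableOn hh.integrableOn

theorem prim_sub {g h : ℝ → ℝ} (hg : Integrable g vol) (hh : Integrable h vol) (x : ℝ) :
    prim (fun t => g t - h t) x = prim g x - prim h x :=
  integral_sub hg.integrableOn hh.integrableOn

theorem prim_const_mul (c : ℝ) (g : ℝ → ℝ) (x : ℝ) :
    prim (fun t => c * g t) x = c * prim g x :=
  integral_const_mul _ _

theorem prim_eq_integral_indicator (g : ℝ → ℝ) (x : ℝ) :
    prim g x = ∫ t, (Iic x).indicator (fun _ => (1 : ℝ)) t * g t ∂vol := by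
  rw [prim, ← integral_indicator measurableSet_Iic]
  congr 1; funext t
  by_cases ht : t ∈ Iic x <;> simp [ht]

theorem sq_prim_sub_le {g : ℝ → ℝ} (hg : MemLp g 2 vol) {x y : ℝ} (hxy : x ≤ y) :
    (prim g y - prim g x) ^ 2 ≤ (y - x) * ∫ t, g t ^ 2 ∂vol := by
  have h1 : prim g y - prim g x = ∫ t, (Ioc x y).indicator (fun _ => (1 : ℝ)) t * g t ∂vol := by
    have hi := integrable_of_memLp hg
    rw [prim, prim, intervalIntegral.integral_Iic_sub_Iic hi.integrableOn hi.integrableOn,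
      intervalIntegral.integral_of_le hxy, ← integral_indicator measurableSet_Ioc]
    congr 1; funext t
    by_cases ht : t ∈ Ioc x y <;> simp [ht]
  have hm : MemLp ((Ioc x y).indicator (fun _ => (1 : ℝ))) 2 vol :=
    (memLp_const 1).indicator measurableSet_Ioc
  rw [h1]
  refine (integral_mul_sq_le hm hg).trans ?_
  refine mul_le_mul_of_nonneg_right ?_ (integral_nonneg fun t => sq_nonneg _)
  have h2 : ∀ t, (Ioc x y).indicator (fun _ => (1 : ℝ)) t ^ 2
      = (Ioc x y).indicator (fun _ => (1 : ℝ)) t := by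
    intro t; by_cases ht : t ∈ Ioc x y <;> simp [ht]
  simp_rw [h2]
  rw [integral_indicator measurableSet_Ioc, setIntegral_const, smul_eq_mul, mul_one]
  refine ENNReal.toReal_le_of_le_ofReal (by linarith) ?_
  refine (Measure.restrict_apply_le _ _).trans ?_
  simp

theorem sq_prim_le {g : ℝ → ℝ} (hg : MemLp g 2 vol) {x : ℝ} (hx : x ∈ Icc (-1 : ℝ) 1) :
    prim g x ^ 2 ≤ 2 * ∫ t, g t ^ 2 ∂vol := by
  have := sq_prim_sub_le hg hx.1
  rw [prim_neg_one, sub_zero] at this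
  refine this.trans (mul_le_mul_of_nonneg_right (by linarith [hx.2])
    (integral_nonneg fun t => sq_nonneg _))

theorem continuous_prim {g : ℝ → ℝ} (hg : Integrable g vol) : Continuous (prim g) := by
  have h : prim g = fun x => prim g (-1) + ∫ t in (-1 : ℝ)..x, g t ∂vol := by
    funext x
    have := intervalIntegral.integral_Iic_sub_Iic (μ := vol) (f := g) (a := -1) (b := x)
      hg.integrableOn hg.integrableOn
    rw [← this]; simp [prim]
  rw [h]
  exact continuous_const.add
    (intervalIntegral.continuous_primitive (fun a b => hg.intervalIntegrable) _)

theorem integrable_iff_intervalIntegrable {g : ℝ → ℝ} :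
    Integrable g vol ↔ IntervalIntegrable g volume (-1) 1 := by
  rw [intervalIntegrable_iff_integrableOn_Ioo_of_le (by norm_num)]; rfl

/-- Integration by parts against the primitive of an integrable function. -/
theorem integral_prim_mul_deriv {g φ φ' : ℝ → ℝ} (hg : Integrable g vol)
    (hφ : ∀ x, HasDerivAt φ (φ' x) x) (hφ' : Continuous φ') :
    ∫ x, prim g x * φ' x ∂vol = prim g 1 * φ 1 - ∫ x, g x * φ x ∂vol := by
  have hg' := integrable_iff_intervalIntegrable.1 hg
  set f : ℝ → ℝ := fun x => ∫ t in (-1 : ℝ)..x, g t with hf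
  have hfac : AbsolutelyContinuousOnInterval f (-1) 1 :=
    hg'.absolutelyContinuousOnInterval_intervalIntegral (by simp)
  have hd : deriv φ = φ' := funext fun x => (hφ x).deriv
  have hφc : ContDiff ℝ 1 φ := by
    rw [contDiff_one_iff_deriv]
    exact ⟨fun x => (hφ x).differentiableAt, hd ▸ hφ'⟩
  have hφac : AbsolutelyContinuousOnInterval φ (-1) 1 :=
    hφc.contDiffOn.absolutelyContinuousOnInterval
  have key := hfac.integral_mul_deriv_eq_deriv_mul hφac
  have hfp : ∀ x ∈ Icc (-1 : ℝ) 1, f x = prim g x := fun x hx => (prim_eq_intervalIntegral g hx).symm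
  have e1 : ∫ x in (-1 : ℝ)..1, f x * deriv φ x = ∫ x, prim g x * φ' x ∂vol := by
    rw [← integral_eq_integral_vol]
    apply intervalIntegral.integral_congr
    intro x hx
    rw [uIcc_of_le (by norm_num)] at hx
    simp only [hfp x hx, hd]
  have e2 : ∫ x in (-1 : ℝ)..1, deriv f x * φ x = ∫ x, g x * φ x ∂vol := by
    rw [← integral_eq_integral_vol]
    apply intervalIntegral.integral_congr_ae
    filter_upwards [hg'.ae_hasDerivAt_integral] with x hx hx2
    rw [(hx (uIoc_subset_uIcc hx2) (-1) (by simp)).deriv]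
  rw [e1, e2, hfp 1 (by simp), hfp (-1) (by simp), prim_neg_one] at key
  simpa using key

end

/-! ### The space `H¹₀(-1, 1)` as the primitives of mean-zero functions -/

section

theorem integral_sub_sq_le {f g h : ℝ → ℝ} (hf : MemLp f 2 vol) (hg : MemLp g 2 vol)
    (hh : MemLp h 2 vol) :
    ∫ x, (f x - h x) ^ 2 ∂vol
      ≤ 2 * (∫ x, (f x - g x) ^ 2 ∂vol) + 2 * ∫ x, (g x - h x) ^ 2 ∂vol := by
  have := integral_add_sq_le (hf.sub hg) (hg.sub hh)
  simpa using this

theorem memLp_prim {g : ℝ → ℝ} (hg : Integrable g vol) : MemLp (prim g) 2 vol :=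
  memLp_of_continuous (continuous_prim hg) 2

theorem ae_vol_of_forall_Icc {p : ℝ → Prop} (h : ∀ x ∈ Icc (-1 : ℝ) 1, p x) : ∀ᵐ x ∂vol, p x := by
  unfold vol
  filter_upwards [ae_restrict_mem measurableSet_Ioo] with x hx
  exact h x (Ioo_subset_Icc_self hx)

theorem integral_prim_sq_le {g : ℝ → ℝ} (hg : MemLp g 2 vol) :
    ∫ x, prim g x ^ 2 ∂vol ≤ 4 * ∫ x, g x ^ 2 ∂vol := by
  have h : ∫ x, prim g x ^ 2 ∂vol ≤ ∫ _, 2 * ∫ t, g t ^ 2 ∂vol ∂vol := by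
    refine integral_mono_ae (memLp_prim (integrable_of_memLp hg)).integrable_sq
      (integrable_const _) ?_
    exact ae_vol_of_forall_Icc fun x hx => sq_prim_le hg hx
  rw [integral_const, vol_real_univ, smul_eq_mul] at h
  linarith

theorem IsTestFunction.apply_eq_zero {φ : ℝ → ℝ} (hφ : IsTestFunction φ) {x : ℝ}
    (hx : x ∉ Ioo (-1 : ℝ) 1) : φ x = 0 :=
  image_eq_zero_of_notMem_tsupport fun h => hx (hφ.support h)

theorem IsTestFunction.hasDerivAt {φ : ℝ → ℝ} (hφ : IsTestFunction φ) (x : ℝ) :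
    HasDerivAt φ (deriv φ x) x :=
  ((hφ.smooth.differentiable (by simp)) x).hasDerivAt

theorem IsTestFunction.continuous_deriv {φ : ℝ → ℝ} (hφ : IsTestFunction φ) :
    Continuous (deriv φ) :=
  hφ.smooth.continuous_deriv (by simp)

theorem IsTestFunction.eq_prim {φ : ℝ → ℝ} (hφ : IsTestFunction φ) {x : ℝ}
    (hx : x ∈ Icc (-1 : ℝ) 1) : φ x = prim (deriv φ) x := by
  rw [prim_eq_intervalIntegral _ hx, intervalIntegral.integral_eq_sub_of_hasDerivAt
    (fun t _ => hφ.hasDerivAt t) (hφ.continuous_deriv.intervalIntegrable _ _),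
    hφ.apply_eq_zero (x := -1) (by simp), sub_zero]

/-- Approximation by test functions, which are the primitives of their derivatives, transfers to the
limit because the primitive is controlled by the `L²` norm. -/
theorem IsH10.integral_sub_prim_sq_le {u u' : ℝ → ℝ} (hu : IsH10 u u') {ε : ℝ} (hε : 0 < ε) :
    ∫ x, (u x - prim u' x) ^ 2 ∂vol ≤ 8 * ε ∧ prim u' 1 ^ 2 ≤ 2 * ε := by
  obtain ⟨φ, hφ, h⟩ := hu.closure ε hε
  rw [integral_eq_integral_vol, integral_eq_integral_vol] at h
  have hd : MemLp (deriv φ) 2 vol := memLp_of_continuous hφ.continuous_deriv 2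
  have hd1 := integrable_of_memLp hd
  have hu1 := integrable_of_memLp hu.memLp_deriv
  have hm : MemLp (fun x => u' x - deriv φ x) 2 vol := hu.memLp_deriv.sub hd
  have h0 : 0 ≤ ∫ x, (u x - φ x) ^ 2 ∂vol := integral_nonneg fun x => sq_nonneg _
  have h0' : 0 ≤ ∫ x, (u' x - deriv φ x) ^ 2 ∂vol := integral_nonneg fun x => sq_nonneg _
  have hp : ∀ x ∈ Icc (-1 : ℝ) 1, prim (fun t => u' t - deriv φ t) x = prim u' x - φ x := by
    intro x hx
    rw [prim_sub hu1 hd1, hφ.eq_prim hx]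
  constructor
  · have h1 := integral_sub_sq_le hu.memLp (memLp_of_continuous hφ.smooth.continuous 2)
      (memLp_prim hu1)
    have h2 : ∫ x, (φ x - prim u' x) ^ 2 ∂vol
        = ∫ x, prim (fun t => u' t - deriv φ t) x ^ 2 ∂vol := by
      apply integral_congr_ae
      refine ae_vol_of_forall_Icc fun x hx => ?_
      simp only [hp x hx]; ring
    have h3 := integral_prim_sq_le hm
    linarith
  · have h1 := sq_prim_le hm (x := 1) (by simp)
    rw [hp 1 (by simp), hφ.apply_eq_zero (x := 1) (by simp), sub_zero] at h1
    linarith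

/-- A function of `H¹₀(-1, 1)` is the primitive of its weak derivative. -/
theorem IsH10.ae_eq_prim {u u' : ℝ → ℝ} (hu : IsH10 u u') : u =ᵐ[vol] prim u' := by
  have hm : MemLp (fun x => u x - prim u' x) 2 vol :=
    hu.memLp.sub (memLp_prim (integrable_of_memLp hu.memLp_deriv))
  have h0 : ∫ x, (u x - prim u' x) ^ 2 ∂vol = 0 := by
    refine le_antisymm (le_of_forall_pos_le_add fun ε hε => ?_)
      (integral_nonneg fun x => sq_nonneg _)
    have := (hu.integral_sub_prim_sq_le (ε := ε / 8) (by positivity)).1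
    linarith
  rw [integral_eq_zero_iff_of_nonneg (fun x => sq_nonneg _) hm.integrable_sq] at h0
  filter_upwards [h0] with x hx
  simpa [sub_eq_zero] using hx

theorem IsH10.prim_deriv_one {u u' : ℝ → ℝ} (hu : IsH10 u u') : prim u' 1 = 0 := by
  have h0 : prim u' 1 ^ 2 = 0 := by
    refine le_antisymm (le_of_forall_pos_le_add fun ε hε => ?_) (sq_nonneg _)
    have := (hu.integral_sub_prim_sq_le (ε := ε / 2) (by positivity)).2
    linarith
  simpa using h0

theorem IsH10.congr {u v u' : ℝ → ℝ} (hu : IsH10 u u') (h : u =ᵐ[vol] v) : IsH10 v u' := by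
  have hi : ∀ F : ℝ → ℝ → ℝ, ∫ x, F (u x) x ∂vol = ∫ x, F (v x) x ∂vol := by
    intro F
    apply integral_congr_ae
    filter_upwards [h] with x hx
    rw [hx]
  refine ⟨(memLp_congr_ae h).1 hu.memLp, hu.memLp_deriv, fun φ hφ => ?_, fun ε hε => ?_⟩
  · have := hu.weakDeriv φ hφ
    rw [integral_eq_integral_vol] at this ⊢
    rw [← this]
    exact (hi fun s x => s * deriv φ x).symm
  · obtain ⟨φ, hφ, h⟩ := hu.closure ε hε
    refine ⟨φ, hφ, ?_⟩
    rw [integral_eq_integral_vol] at h ⊢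
    rw [← hi fun s x => (s - φ x) ^ 2]
    exact h

theorem exists_isTestFunction_deriv_eq {ψ : ℝ → ℝ} (hψ : ContDiff ℝ ∞ ψ) {r : ℝ}
    (hr1 : r < 1) (hs : ∀ x, x ∉ Icc (-r) r → ψ x = 0) (h0 : ∫ x, ψ x ∂vol = 0) :
    ∃ φ, IsTestFunction φ ∧ deriv φ = ψ := by
  set φ : ℝ → ℝ := fun x => ∫ t in (-1 : ℝ)..x, ψ t with hφ
  have hc := hψ.continuous
  have hd : ∀ x, HasDerivAt φ (ψ x) x := fun x =>
    intervalIntegral.integral_hasDerivAt_right (hc.intervalIntegrable _ _)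
      (hc.stronglyMeasurableAtFilter _ _) hc.continuousAt
  have hder : deriv φ = ψ := funext fun x => (hd x).deriv
  have hsupp : ∀ x, x ∉ Icc (-r) r → φ x = 0 := by
    intro x hx
    have hcase : x < -r ∨ r < x := by
      by_contra! h; exact hx ⟨h.1, h.2⟩
    rcases hcase with hx | hx
    · apply intervalIntegral.integral_zero_ae
      refine Filter.Eventually.of_forall fun t ht => hs t fun htr => ?_
      have := htr.1
      rcases le_total (-1) x with h | h
      · rw [uIoc_of_le h] at ht; linarith [ht.2]
      · rw [uIoc_of_ge h] at ht; linarith [ht.2]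
    · have h1 : ∫ t in (1 : ℝ)..x, ψ t = 0 := by
        apply intervalIntegral.integral_zero_ae
        refine Filter.Eventually.of_forall fun t ht => hs t fun htr => ?_
        have := htr.2
        rcases le_total 1 x with h | h
        · rw [uIoc_of_le h] at ht; linarith [ht.1]
        · rw [uIoc_of_ge h] at ht; linarith [ht.1]
      have h2 := intervalIntegral.integral_add_adjacent_intervals
        (hc.intervalIntegrable (μ := volume) (-1) 1) (hc.intervalIntegrable (μ := volume) 1 x)
      rw [h1, integral_eq_integral_vol, h0] at h2
      rw [hφ]; simp only; rw [← h2]; simp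
  have ht : tsupport φ ⊆ Icc (-r) r :=
    closure_minimal (fun x hx => by_contra fun h => hx (hsupp x h)) isClosed_Icc
  refine ⟨φ, ⟨?_, ?_, ?_⟩, hder⟩
  · rw [contDiff_infty_iff_deriv]
    exact ⟨fun x => (hd x).differentiableAt, hder ▸ hψ⟩
  · exact isCompact_Icc.of_isClosed_subset (isClosed_tsupport _) ht
  · exact ht.trans fun x hx => ⟨by linarith [hx.1], by linarith [hx.2]⟩

theorem integral_sq_le_of_eLpNorm_le {f : ℝ → ℝ} (hf : MemLp f 2 vol) {δ : ℝ} (hδ : 0 ≤ δ)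
    (h : eLpNorm f 2 vol ≤ ENNReal.ofReal δ) : ∫ x, f x ^ 2 ∂vol ≤ δ ^ 2 := by
  have h1 := hf.eLpNorm_eq_integral_rpow_norm (by norm_num) (by norm_num)
  rw [h1, ENNReal.ofReal_le_ofReal_iff hδ] at h
  have h0 : 0 ≤ ∫ x, f x ^ 2 ∂vol := integral_nonneg fun x => sq_nonneg _
  have h2 : ∫ x, ‖f x‖ ^ (ENNReal.toReal 2) ∂vol = ∫ x, f x ^ 2 ∂vol := by
    congr 1; funext x; simp
  rw [h2] at h
  have h3 : (∫ x, f x ^ 2 ∂vol) ^ ((ENNReal.toReal 2)⁻¹) = √(∫ x, f x ^ 2 ∂vol) := by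
    rw [Real.sqrt_eq_rpow]; norm_num
  rw [h3] at h
  exact (Real.sqrt_le_left hδ).1 h

/-- Smooth functions supported in a compact subinterval are dense in `L²(-1, 1)`. -/
theorem exists_contDiff_integral_sub_sq_le {g : ℝ → ℝ} (hg : MemLp g 2 vol) {ε : ℝ} (hε : 0 < ε) :
    ∃ ψ : ℝ → ℝ, ContDiff ℝ ∞ ψ ∧ (∃ r, 1 / 2 ≤ r ∧ r < 1 ∧ ∀ x, x ∉ Icc (-r) r → ψ x = 0) ∧
      ∫ x, (g x - ψ x) ^ 2 ∂vol ≤ ε := by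
  obtain ⟨ψ, hψc, hψ, hle⟩ := hg.exist_eLpNorm_sub_le (by norm_num) (by norm_num)
    (show 0 < √(ε / 4) by positivity)
  have hψ2 : MemLp ψ 2 vol := memLp_of_continuous hψ.continuous 2
  have h1 : ∫ x, (g x - ψ x) ^ 2 ∂vol ≤ ε / 4 := by
    have := integral_sq_le_of_eLpNorm_le (hg.sub hψ2) (Real.sqrt_nonneg _) hle
    rwa [Real.sq_sqrt (by positivity)] at this
  obtain ⟨C, hC⟩ := hψc.exists_bound_of_continuous hψ.continuous
  have hC0 : 0 ≤ C := (norm_nonneg _).trans (hC 0)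
  -- the cutoff equals `1` on `[-(1 - δ), 1 - δ]`, up to a set of measure `2 δ`
  set δ : ℝ := min (1 / 4) (ε / (8 * (C ^ 2 + 1))) with hδ
  have hδ0 : 0 < δ := by positivity
  have hδ1 : δ ≤ 1 / 4 := min_le_left _ _
  have hδC : C ^ 2 * (2 * δ) ≤ ε / 4 := by
    have : δ ≤ ε / (8 * (C ^ 2 + 1)) := min_le_right _ _
    rw [le_div_iff₀ (by positivity)] at this
    nlinarith
  let χ : ContDiffBump (0 : ℝ) := ⟨1 - δ, 1 - δ / 2, by linarith, by linarith⟩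
  refine ⟨fun x => χ x * ψ x, χ.contDiff.mul hψ, ⟨1 - δ / 2, by linarith, by linarith, ?_⟩, ?_⟩
  · intro x hx
    have : χ x = 0 := by
      apply χ.zero_of_le_dist
      simp only [Real.dist_eq, sub_zero]
      by_contra! h
      exact hx (abs_le.1 h.le)
    simp [this]
  have hχ2 : MemLp (fun x => χ x * ψ x) 2 vol :=
    memLp_of_continuous (χ.continuous.mul hψ.continuous) 2
  have h2 : ∫ x, (ψ x - χ x * ψ x) ^ 2 ∂vol ≤ ε / 4 := by
    have hb : ∀ x, (ψ x - χ x * ψ x) ^ 2 ≤ ((Icc (-(1 - δ)) (1 - δ))ᶜ).indicator (fun _ => C ^ 2) x := by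
      intro x
      by_cases hx : x ∈ Icc (-(1 - δ)) (1 - δ)
      · have : χ x = 1 := χ.one_of_mem_closedBall (by
          rw [Metric.mem_closedBall, Real.dist_eq, sub_zero]; exact abs_le.2 hx)
        rw [indicator_of_notMem (by simpa using hx), this]
        simp
      · rw [indicator_of_mem (by exact hx)]
        have h3 := χ.nonneg' x
        have h4 := χ.le_one (x := x)
        have h5 : ψ x ^ 2 ≤ C ^ 2 := by
          rw [← sq_abs]; exact pow_le_pow_left₀ (abs_nonneg _) (hC x) 2
        have h6 : (ψ x - χ x * ψ x) ^ 2 = (1 - χ x) ^ 2 * ψ x ^ 2 := by ring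
        have h7 : (1 - χ x) ^ 2 ≤ 1 := by nlinarith
        rw [h6]; nlinarith [sq_nonneg (ψ x)]
    have hm : MeasurableSet ((Icc (-(1 - δ)) (1 - δ))ᶜ) := measurableSet_Icc.compl
    have h3 : ∫ x, (ψ x - χ x * ψ x) ^ 2 ∂vol
        ≤ ∫ x, ((Icc (-(1 - δ)) (1 - δ))ᶜ).indicator (fun _ => C ^ 2) x ∂vol :=
      integral_mono (hψ2.sub hχ2).integrable_sq ((integrable_const _).indicator hm) hb
    rw [integral_indicator hm, setIntegral_const, smul_eq_mul] at h3
    have h4 : vol.real ((Icc (-(1 - δ)) (1 - δ))ᶜ) ≤ 2 * δ := by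
      rw [measureReal_compl measurableSet_Icc, vol_real_univ]
      have : vol.real (Icc (-(1 - δ)) (1 - δ)) = 2 - 2 * δ := by
        rw [Measure.real, vol, Measure.restrict_apply measurableSet_Icc,
          inter_eq_left.2 (show Icc (-(1 - δ)) (1 - δ) ⊆ Ioo (-1 : ℝ) 1 from
            fun x hx => ⟨by linarith [hx.1], by linarith [hx.2]⟩), Real.volume_Icc,
          ENNReal.toReal_ofReal (by linarith)]
        ring
      linarith
    nlinarith [sq_nonneg C]
  have h3 := integral_sub_sq_le hg hψ2 hχ2
  linarith

/-- The primitive of a mean-zero `L²` function is in `H¹₀(-1, 1)`. -/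
theorem isH10_prim {g : ℝ → ℝ} (hg : MemLp g 2 vol) (h0 : prim g 1 = 0) : IsH10 (prim g) g := by
  have hgi := integrable_of_memLp hg
  refine ⟨memLp_prim hgi, hg, fun φ hφ => ?_, fun ε hε => ?_⟩
  · rw [integral_eq_integral_vol, integral_eq_integral_vol,
      integral_prim_mul_deriv hgi hφ.hasDerivAt hφ.continuous_deriv, h0]
    ring
  · let b : ContDiffBump (0 : ℝ) := ⟨1 / 4, 1 / 2, by norm_num, by norm_num⟩
    set η : ℝ → ℝ := b.normed volume with hη
    have hηs : ContDiff ℝ ∞ η := b.contDiff_normed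
    have hη0 : ∀ x, x ∉ Icc (-(1 / 2) : ℝ) (1 / 2) → η x = 0 := by
      intro x hx
      have : x ∉ Function.support (b.normed volume) := by
        rw [b.support_normed_eq]
        intro h
        rw [Metric.mem_ball, Real.dist_eq, sub_zero] at h
        exact hx (abs_le.1 h.le)
      simpa using this
    have hη1 : ∫ x, η x ∂vol = 1 := by
      rw [← b.integral_normed (μ := volume), vol]
      apply setIntegral_eq_integral_of_forall_compl_eq_zero
      intro x hx
      apply hη0 x fun h => hx ⟨by linarith [h.1], by linarith [h.2]⟩
    have hη2 : MemLp η 2 vol := memLp_of_continuous hηs.continuous 2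
    set K := ∫ x, η x ^ 2 ∂vol
    have hK : 0 ≤ K := integral_nonneg fun x => sq_nonneg _
    obtain ⟨ψ, hψ, ⟨r, hr, hr1, hs⟩, hle⟩ := exists_contDiff_integral_sub_sq_le hg
      (show 0 < ε / (6 * (2 + 4 * K)) by positivity)
    rw [le_div_iff₀ (by positivity)] at hle
    have hψ2 : MemLp ψ 2 vol := memLp_of_continuous hψ.continuous 2
    set D := ∫ x, (g x - ψ x) ^ 2 ∂vol with hD
    have hD0 : 0 ≤ D := integral_nonneg fun x => sq_nonneg _
    set m := ∫ x, ψ x ∂vol with hm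
    have hm2 : m ^ 2 ≤ 2 * D := by
      have h1 := sq_prim_le (hg.sub hψ2) (x := 1) (by simp)
      have h2 : prim (g - ψ) 1 = prim g 1 - prim ψ 1 := prim_sub hgi (integrable_of_memLp hψ2) 1
      rw [h2, h0, prim_one ψ] at h1
      simpa using h1
    have hsm : ContDiff ℝ ∞ (fun x => ψ x - m * η x) := hψ.sub (contDiff_const.mul hηs)
    obtain ⟨φ, hφ, hφd⟩ := exists_isTestFunction_deriv_eq (r := r) hsm
      hr1 (by
        intro x hx
        rw [hs x hx, hη0 x fun h => hx ⟨by linarith [h.1], by linarith [h.2]⟩]; ring) (by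
        rw [integral_sub (integrable_of_memLp hψ2) ((integrable_of_memLp hη2).const_mul m),
          integral_const_mul, hη1, ← hm]; ring)
    refine ⟨φ, hφ, ?_⟩
    rw [integral_eq_integral_vol, integral_eq_integral_vol]
    have hmd : MemLp (deriv φ) 2 vol := memLp_of_continuous hφ.continuous_deriv 2
    have hmm : MemLp (fun x => g x - deriv φ x) 2 vol := hg.sub hmd
    have h1 : ∫ x, (prim g x - φ x) ^ 2 ∂vol ≤ 4 * ∫ x, (g x - deriv φ x) ^ 2 ∂vol := by
      refine le_trans (le_of_eq ?_) (integral_prim_sq_le hmm)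
      apply integral_congr_ae
      refine ae_vol_of_forall_Icc fun x hx => ?_
      beta_reduce
      rw [prim_sub hgi (integrable_of_memLp hmd), hφ.eq_prim hx]
    have h2 : ∫ x, (g x - deriv φ x) ^ 2 ∂vol ≤ 2 * D + 2 * (m ^ 2 * K) := by
      have h3 := integral_add_sq_le (hg.sub hψ2) (hη2.const_mul m)
      have h4 : ∫ x, (m * η x) ^ 2 ∂vol = m ^ 2 * K := by
        rw [← integral_const_mul]; congr 1; funext x; ring
      rw [h4] at h3
      refine le_trans (le_of_eq ?_) h3
      congr 1; funext x; simp only [hφd, Pi.sub_apply]; ring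
    nlinarith

end

/-! ### Comparison of positive and negative quarter arcs -/

section

/-- `w`, with derivative `w'`, is a quarter of an oscillation of `w'' + lam * w = κ * w ^ (q - 1)`:
it leaves the value `0` with slope `p` and increases until time `T`, where its slope vanishes for
the first time. Negative arcs `y < 0` of the equation `y'' + lam * y = κ * |y| ^ (q - 1)` are
described by `w = -y` and the coefficient `-κ`. -/
structure QuarterArc (lam κ q p T : ℝ) (w w' : ℝ → ℝ) : Prop where
  nonneg : 0 ≤ T
  hasDerivAt : ∀ s ∈ Icc 0 T, HasDerivAt w (w' s) s
  hasDerivAt_deriv : ∀ s ∈ Icc 0 T, HasDerivAt w' (κ * w s ^ (q - 1) - lam * w s) s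
  zero : w 0 = 0
  slope : w' 0 = p
  slope_end : w' T = 0
  slope_pos : ∀ s ∈ Ioo 0 T, 0 < w' s

variable {lam κ q p T t : ℝ} {w w' z z' : ℝ → ℝ}

theorem QuarterArc.continuousOn (h : QuarterArc lam κ q p T w w') : ContinuousOn w (Icc 0 T) :=
  fun s hs => (h.hasDerivAt s hs).continuousAt.continuousWithinAt

theorem QuarterArc.strictMonoOn (h : QuarterArc lam κ q p T w w') : StrictMonoOn w (Icc 0 T) := by
  refine strictMonoOn_of_deriv_pos (convex_Icc _ _) h.continuousOn fun s hs => ?_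
  rw [interior_Icc] at hs
  rw [(h.hasDerivAt s (Ioo_subset_Icc_self hs)).deriv]
  exact h.slope_pos s hs

theorem QuarterArc.apply_nonneg (h : QuarterArc lam κ q p T w w') {s : ℝ} (hs : s ∈ Icc 0 T) :
    0 ≤ w s := by
  rw [← h.zero]
  exact h.strictMonoOn.monotoneOn ⟨le_rfl, h.nonneg⟩ hs hs.1

theorem QuarterArc.apply_pos (h : QuarterArc lam κ q p T w w') {s : ℝ} (hs : s ∈ Ioc 0 T) :
    0 < w s := by
  rw [← h.zero]
  exact h.strictMonoOn ⟨le_rfl, h.nonneg⟩ ⟨hs.1.le, hs.2⟩ hs.1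

theorem QuarterArc.continuousOn_rpow (h : QuarterArc lam κ q p T w w') (hq : 1 ≤ q) :
    ContinuousOn (fun s => w s ^ (q - 1)) (Icc 0 T) :=
  h.continuousOn.rpow_const fun _ _ => Or.inr (by linarith)

theorem QuarterArc.monotoneOn_rpow (h : QuarterArc lam κ q p T w w') (hq : 1 ≤ q) :
    MonotoneOn (fun s => w s ^ (q - 1)) (Icc 0 T) := fun _ hx _ hy hxy =>
  Real.rpow_le_rpow (h.apply_nonneg hx) (h.strictMonoOn.monotoneOn hx hy hxy) (by linarith)

theorem hasDerivAt_wronskian (hw : QuarterArc lam κ q p T w w')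
    (hz : QuarterArc lam (-κ) q p t z z') {s : ℝ} (hs : s ∈ Icc 0 (min T t)) :
    HasDerivAt (fun s => w' s * z s - w s * z' s)
      (κ * (w s ^ (q - 1) * z s + w s * z s ^ (q - 1))) s := by
  have h1 : s ∈ Icc 0 T := ⟨hs.1, hs.2.trans (min_le_left _ _)⟩
  have h2 : s ∈ Icc 0 t := ⟨hs.1, hs.2.trans (min_le_right _ _)⟩
  refine (((hw.hasDerivAt_deriv s h1).mul (hz.hasDerivAt s h2)).sub
    ((hw.hasDerivAt s h1).mul (hz.hasDerivAt_deriv s h2))).congr_deriv ?_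
  ring

/-- The Wronskian of a positive and a negative arc is nondecreasing: the linear terms cancel and the
nonlinear ones add up. -/
theorem wronskian_nonneg (hκ : 0 ≤ κ) (hw : QuarterArc lam κ q p T w w')
    (hz : QuarterArc lam (-κ) q p t z z') {s : ℝ} (hs : s ∈ Icc 0 (min T t)) :
    0 ≤ w' s * z s - w s * z' s := by
  have hm : MonotoneOn (fun s => w' s * z s - w s * z' s) (Icc 0 (min T t)) := by
    refine monotoneOn_of_deriv_nonneg (convex_Icc _ _)
      (fun x hx => (hasDerivAt_wronskian hw hz hx).continuousAt.continuousWithinAt)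
      (fun x hx => ?_) (fun x hx => ?_) <;> rw [interior_Icc] at hx
    · exact (hasDerivAt_wronskian hw hz
        (Ioo_subset_Icc_self hx)).differentiableAt.differentiableWithinAt
    · rw [(hasDerivAt_wronskian hw hz (Ioo_subset_Icc_self hx)).deriv]
      have h1 := hw.apply_nonneg (s := x) ⟨hx.1.le, hx.2.le.trans (min_le_left _ _)⟩
      have h2 := hz.apply_nonneg (s := x) ⟨hx.1.le, hx.2.le.trans (min_le_right _ _)⟩
      positivity
  have := hm ⟨le_rfl, hs.1.trans hs.2⟩ hs hs.1
  simpa [hw.zero, hz.zero] using this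

theorem wronskian_pos (hκ : 0 < κ) (hw : QuarterArc lam κ q p T w w')
    (hz : QuarterArc lam (-κ) q p t z z') {s : ℝ} (hs : s ∈ Ioc 0 (min T t)) :
    0 < w' s * z s - w s * z' s := by
  have hm : StrictMonoOn (fun s => w' s * z s - w s * z' s) (Icc 0 (min T t)) := by
    refine strictMonoOn_of_deriv_pos (convex_Icc _ _)
      (fun x hx => (hasDerivAt_wronskian hw hz hx).continuousAt.continuousWithinAt)
      (fun x hx => ?_)
    rw [interior_Icc] at hx
    rw [(hasDerivAt_wronskian hw hz (Ioo_subset_Icc_self hx)).deriv]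
    have h1 := hw.apply_pos (s := x) ⟨hx.1, hx.2.le.trans (min_le_left _ _)⟩
    have h2 := hz.apply_pos (s := x) ⟨hx.1, hx.2.le.trans (min_le_right _ _)⟩
    positivity
  have := hm ⟨le_rfl, hs.1.le.trans hs.2⟩ ⟨hs.1.le, hs.2⟩ hs.1
  simpa [hw.zero, hz.zero] using this

/-- The negative quarter arc is not longer than the positive one. -/
theorem QuarterArc.le_of_neg (hκ : 0 ≤ κ) (hT : 0 < T) (hw : QuarterArc lam κ q p T w w')
    (hz : QuarterArc lam (-κ) q p t z z') : t ≤ T := by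
  by_contra! h
  have h1 := wronskian_nonneg hκ hw hz (s := T) ⟨hT.le, le_min le_rfl h.le⟩
  rw [hw.slope_end] at h1
  nlinarith [hw.apply_pos (s := T) ⟨hT, le_rfl⟩, hz.slope_pos T ⟨hT, h⟩,
    mul_pos (hw.apply_pos (s := T) ⟨hT, le_rfl⟩) (hz.slope_pos T ⟨hT, h⟩)]

/-- Leaving `0` with the same slope, the positive arc stays above the negative one: the quotient of
the two is nondecreasing and tends to `1` at time `0`. -/
theorem QuarterArc.apply_le_of_neg (hκ : 0 ≤ κ) (hT : 0 < T) (hw : QuarterArc lam κ q p T w w')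
    (hz : QuarterArc lam (-κ) q p t z z') (hp : 0 < p ∨ t = 0) {s : ℝ} (hs : s ∈ Icc 0 t) :
    z s ≤ w s := by
  have htT := hw.le_of_neg hκ hT hz
  have hmin : min T t = t := min_eq_right htT
  rcases hs.1.eq_or_lt with h0 | h0
  · rw [← h0, hw.zero, hz.zero]
  replace hp : 0 < p := hp.resolve_right (by linarith [hs.2])
  by_contra! hlt
  have hzs := hz.apply_pos ⟨h0, hs.2⟩
  have hmono : MonotoneOn (fun x => w x / z x) (Ioc 0 s) := by
    have hd : ∀ x ∈ Ioc 0 s, HasDerivAt (fun x => w x / z x)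
        ((w' x * z x - w x * z' x) / z x ^ 2) x := fun x hx =>
      (hw.hasDerivAt x ⟨hx.1.le, by linarith [hx.2, hs.2]⟩).div
        (hz.hasDerivAt x ⟨hx.1.le, by linarith [hx.2, hs.2]⟩)
        (hz.apply_pos ⟨hx.1, by linarith [hx.2, hs.2]⟩).ne'
    refine monotoneOn_of_deriv_nonneg (convex_Ioc _ _)
      (fun x hx => (hd x hx).continuousAt.continuousWithinAt)
      (fun x hx => ?_) (fun x hx => ?_) <;> rw [interior_Ioc] at hx
    · exact (hd x (Ioo_subset_Ioc_self hx)).differentiableAt.differentiableWithinAt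
    · rw [(hd x (Ioo_subset_Ioc_self hx)).deriv]
      exact div_nonneg (wronskian_nonneg hκ hw hz
        ⟨hx.1.le, by rw [hmin]; linarith [hx.2, hs.2]⟩) (sq_nonneg _)
  set r := w s / z s with hr
  have hr1 : r < 1 := (div_lt_one hzs).2 hlt
  have hle : ∀ x ∈ Ioc 0 s, w x ≤ r * z x := fun x hx =>
    (div_le_iff₀ (hz.apply_pos ⟨hx.1, hx.2.trans hs.2⟩)).1 (hmono hx ⟨h0, le_rfl⟩ hx.2)
  have hw0 := (hw.hasDerivAt 0 ⟨le_rfl, hT.le⟩).tendsto_slope_zero_right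
  have hz0 := ((hz.hasDerivAt 0 ⟨le_rfl, hz.nonneg⟩).tendsto_slope_zero_right).const_mul r
  have hlim : w' 0 ≤ r * z' 0 := by
    refine le_of_tendsto_of_tendsto hw0 hz0 ?_
    filter_upwards [Ioo_mem_nhdsGT h0] with x hx
    have := hle x ⟨hx.1, hx.2.le⟩
    simp only [zero_add, hw.zero, hz.zero, sub_zero, smul_eq_mul]
    have hx' : 0 < x⁻¹ := inv_pos.2 hx.1
    nlinarith
  rw [hw.slope, hz.slope] at hlim
  nlinarith

/-- Testing the equation against a cosine that peaks at the end of the arc. -/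
theorem QuarterArc.integral_mul_cos (hq : 1 ≤ q) (hw : QuarterArc lam κ q p T w w') (θ : ℝ) :
    κ * (∫ s in (0 : ℝ)..T, w s ^ (q - 1) * Real.cos (θ * (T - s)))
      - (lam - θ ^ 2) * (∫ s in (0 : ℝ)..T, w s * Real.cos (θ * (T - s)))
      = -(p * Real.cos (θ * T)) := by
  have hcos : Continuous fun s => Real.cos (θ * (T - s)) := by fun_prop
  have hu : uIcc 0 T = Icc 0 T := uIcc_of_le hw.nonneg
  have hi1 : IntervalIntegrable (fun s => w s ^ (q - 1) * Real.cos (θ * (T - s))) volume 0 T :=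
    ContinuousOn.intervalIntegrable (by
      rw [hu]; exact (hw.continuousOn_rpow hq).mul hcos.continuousOn)
  have hi2 : IntervalIntegrable (fun s => w s * Real.cos (θ * (T - s))) volume 0 T :=
    ContinuousOn.intervalIntegrable (by rw [hu]; exact hw.continuousOn.mul hcos.continuousOn)
  have hd : ∀ s ∈ uIcc 0 T, HasDerivAt
      (fun s => w' s * Real.cos (θ * (T - s)) - θ * (w s * Real.sin (θ * (T - s))))
      (κ * (w s ^ (q - 1) * Real.cos (θ * (T - s)))
        - (lam - θ ^ 2) * (w s * Real.cos (θ * (T - s)))) s := by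
    intro s hs
    rw [hu] at hs
    have ha : HasDerivAt (fun s => θ * (T - s)) (-θ) s :=
      (((hasDerivAt_id s).const_sub T).const_mul θ).congr_deriv (by ring)
    refine (((hw.hasDerivAt_deriv s hs).mul ha.cos).sub
      (((hw.hasDerivAt s hs).mul ha.sin).const_mul θ)).congr_deriv ?_
    ring
  have h := intervalIntegral.integral_eq_sub_of_hasDerivAt hd
    ((hi1.const_mul _).sub (hi2.const_mul _))
  rw [intervalIntegral.integral_sub (hi1.const_mul _) (hi2.const_mul _),
    intervalIntegral.integral_const_mul, intervalIntegral.integral_const_mul] at h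
  rw [h]
  simp [hw.slope_end, hw.zero, hw.slope]

/-- For a nondecreasing `g`, the part of the cosine integral over `[0, T - t]`, where the cosine is
odd with respect to the midpoint, is nonnegative. -/
theorem integral_mul_cos_antisymm_nonneg {g : ℝ → ℝ} (ht : 0 ≤ t) (htT : t ≤ T) (hT : 0 < T)
    (hg : MonotoneOn g (Icc 0 T)) (hgc : ContinuousOn g (Icc 0 T)) :
    0 ≤ ∫ s in (0 : ℝ)..(T - t), g s * Real.cos (Real.pi / (T + t) * (T - s)) ∧
    (t < T → StrictMonoOn g (Icc 0 T) →
      0 < ∫ s in (0 : ℝ)..(T - t), g s * Real.cos (Real.pi / (T + t) * (T - s))) := by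
  set θ := Real.pi / (T + t) with hθ
  have hl : 0 < T + t := by linarith
  have hθ0 : 0 < θ := by positivity
  have hθl : θ * (T + t) = Real.pi := by rw [hθ]; field_simp
  set a := T - t with ha
  have ha0 : 0 ≤ a := by linarith
  have haT : a ≤ T := by linarith
  have hcos : Continuous fun s => Real.cos (θ * (T - s)) := by fun_prop
  have hsub : Icc 0 a ⊆ Icc 0 T := Icc_subset_Icc_right haT
  have hc1 : ContinuousOn (fun s => g s * Real.cos (θ * (T - s))) (Icc 0 a) :=
    (hgc.mono hsub).mul hcos.continuousOn
  have hc2 : ContinuousOn (fun s => g (a - s) * Real.cos (θ * (T - s))) (Icc 0 a) := by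
    refine ContinuousOn.mul ?_ hcos.continuousOn
    exact (hgc.mono hsub).comp (by fun_prop) fun s hs => ⟨by linarith [hs.2], by linarith [hs.1]⟩
  have hi1 : IntervalIntegrable (fun s => g s * Real.cos (θ * (T - s))) volume 0 a :=
    ContinuousOn.intervalIntegrable (by rwa [uIcc_of_le ha0])
  have hi2 : IntervalIntegrable (fun s => g (a - s) * Real.cos (θ * (T - s))) volume 0 a :=
    ContinuousOn.intervalIntegrable (by rwa [uIcc_of_le ha0])
  have hodd : ∀ s, Real.cos (θ * (T - (a - s))) = -Real.cos (θ * (T - s)) := by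
    intro s
    have : θ * (T - (a - s)) = Real.pi - θ * (T - s) := by rw [← hθl, ha]; ring
    rw [this, Real.cos_pi_sub]
  have hrefl : ∫ s in (0 : ℝ)..a, g s * Real.cos (θ * (T - s))
      = -∫ s in (0 : ℝ)..a, g (a - s) * Real.cos (θ * (T - s)) := by
    have h := intervalIntegral.integral_comp_sub_left
      (fun s => g s * Real.cos (θ * (T - s))) a (a := 0) (b := a)
    simp only [sub_zero, sub_self, hodd] at h
    rw [← h, ← intervalIntegral.integral_neg]
    congr 1; funext s; ring
  have hdouble : 2 * ∫ s in (0 : ℝ)..a, g s * Real.cos (θ * (T - s))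
      = ∫ s in (0 : ℝ)..a, (g s - g (a - s)) * Real.cos (θ * (T - s)) := by
    simp_rw [sub_mul]
    rw [intervalIntegral.integral_sub hi1 hi2]
    linarith
  have hcpos : ∀ s ∈ Icc 0 a, a / 2 ≤ s → 0 ≤ Real.cos (θ * (T - s)) := by
    intro s hs h
    apply Real.cos_nonneg_of_neg_pi_div_two_le_of_le
    · have : 0 ≤ θ * (T - s) := mul_nonneg hθ0.le (by linarith [hs.2])
      linarith [Real.pi_pos]
    · rw [← hθl, mul_div_assoc]
      exact mul_le_mul_of_nonneg_left (by linarith) hθ0.le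
  have hcneg : ∀ s ∈ Icc 0 a, s ≤ a / 2 → Real.cos (θ * (T - s)) ≤ 0 := by
    intro s hs h
    have h1 := hcpos (a - s) ⟨by linarith [hs.2], by linarith [hs.1]⟩ (by linarith)
    rw [hodd] at h1
    linarith
  have hnonneg : ∀ s ∈ Icc 0 a, 0 ≤ (g s - g (a - s)) * Real.cos (θ * (T - s)) := by
    intro s hs
    have hs' : a - s ∈ Icc 0 a := ⟨by linarith [hs.2], by linarith [hs.1]⟩
    rcases le_total (a / 2) s with h | h
    · exact mul_nonneg (sub_nonneg.2 (hg (hsub hs') (hsub hs) (by linarith))) (hcpos s hs h)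
    · exact mul_nonneg_of_nonpos_of_nonpos
        (sub_nonpos.2 (hg (hsub hs) (hsub hs') (by linarith))) (hcneg s hs h)
  constructor
  · have := intervalIntegral.integral_nonneg (μ := volume) ha0 hnonneg
    linarith
  · intro hlt hs
    have ha1 : 0 < a := by linarith
    have hpos : 0 < ∫ s in (0 : ℝ)..a, (g s - g (a - s)) * Real.cos (θ * (T - s)) := by
      refine intervalIntegral.integral_pos ha1 ?_
        (fun s hs => hnonneg s (Ioc_subset_Icc_self hs)) ⟨a, ⟨ha0, le_rfl⟩, ?_⟩
      · simp_rw [sub_mul]; exact hc1.sub hc2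
      · refine mul_pos (sub_pos.2 (hs (hsub ⟨by linarith, by linarith⟩)
          (hsub ⟨ha0, le_rfl⟩) (by linarith))) ?_
        apply Real.cos_pos_of_mem_Ioo
        constructor
        · have : 0 ≤ θ * (T - a) := mul_nonneg hθ0.le (by linarith)
          linarith [Real.pi_pos]
        · rw [← hθl, mul_div_assoc]
          exact mul_lt_mul_of_pos_left (by linarith) hθ0
    linarith

theorem integral_mul_cos_split {g : ℝ → ℝ} (ht : 0 ≤ t) (htT : t ≤ T)
    (hgc : ContinuousOn g (Icc 0 T)) (θ : ℝ) :
    ∫ s in (0 : ℝ)..T, g s * Real.cos (θ * (T - s))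
      = (∫ s in (0 : ℝ)..(T - t), g s * Real.cos (θ * (T - s)))
        + ∫ s in (0 : ℝ)..t, g (T - t + s) * Real.cos (θ * (t - s)) := by
  have hcos : Continuous fun s => Real.cos (θ * (T - s)) := by fun_prop
  have hc : ContinuousOn (fun s => g s * Real.cos (θ * (T - s))) (Icc 0 T) :=
    hgc.mul hcos.continuousOn
  rw [← intervalIntegral.integral_add_adjacent_intervals (b := T - t)
    (ContinuousOn.intervalIntegrable (by
      rw [uIcc_of_le (by linarith)]; exact hc.mono (Icc_subset_Icc_right (by linarith))))
    (ContinuousOn.intervalIntegrable (by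
      rw [uIcc_of_le (by linarith)]; exact hc.mono (Icc_subset_Icc_left (by linarith))))]
  congr 1
  have h := intervalIntegral.integral_comp_add_left
    (fun s => g s * Real.cos (θ * (T - s))) (T - t) (a := 0) (b := t)
  rw [add_zero, sub_add_cancel] at h
  rw [← h]
  congr 1; funext s
  congr 3; ring

/-- The lengths of a positive and a negative quarter arc add up to at least half the period
`2 * π / √lam` of the linear equation `u'' + lam * u = 0`. The identities of
`QuarterArc.integral_mul_cos` for the two arcs, with `θ = π / (T + t)`, have opposite right-hand sides;
in their sum the factor of `lam - θ ^ 2` is positive and the factor of `κ` is nonnegative. -/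
theorem QuarterArc.sq_le (hq : 1 ≤ q) (hκ : 0 ≤ κ) (hT : 0 < T)
    (hw : QuarterArc lam κ q p T w w') (hz : QuarterArc lam (-κ) q p t z z')
    (hp : 0 < p ∨ t = 0) : (Real.pi / (T + t)) ^ 2 ≤ lam := by
  have htT := hw.le_of_neg hκ hT hz
  have ht := hz.nonneg
  set θ := Real.pi / (T + t) with hθ
  have hl : 0 < T + t := by linarith
  have hθ0 : 0 < θ := by positivity
  have hθl : θ * (T + t) = Real.pi := by rw [hθ]; field_simp
  have h1 := hw.integral_mul_cos hq θ
  have h2 := hz.integral_mul_cos hq θ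
  have hθt : Real.cos (θ * t) = -Real.cos (θ * T) := by
    rw [← Real.cos_pi_sub]; congr 1; rw [← hθl]; ring
  rw [hθt] at h2
  have hcos : ∀ s ∈ Icc 0 t, 0 ≤ Real.cos (θ * (t - s)) := by
    intro s hs
    apply Real.cos_nonneg_of_neg_pi_div_two_le_of_le
    · have : 0 ≤ θ * (t - s) := mul_nonneg hθ0.le (by linarith [hs.2])
      linarith [Real.pi_pos]
    · rw [← hθl, mul_div_assoc]
      exact mul_le_mul_of_nonneg_left (by linarith [hs.1]) hθ0.le
  have hcosc : Continuous fun s => Real.cos (θ * (t - s)) := by fun_prop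
  have hmaps : MapsTo (fun s => T - t + s) (Icc 0 t) (Icc 0 T) := fun s hs =>
    ⟨by linarith [hs.1], by linarith [hs.2]⟩
  have hshift : ContinuousOn (fun s => T - t + s) (Icc 0 t) := by fun_prop
  have hu : uIcc 0 t = Icc 0 t := uIcc_of_le ht
  -- the weighted integral of the two arcs is positive
  have hpos : 0 < (∫ s in (0 : ℝ)..T, w s * Real.cos (θ * (T - s)))
      + ∫ s in (0 : ℝ)..t, z s * Real.cos (θ * (t - s)) := by
    rw [integral_mul_cos_split ht htT hw.continuousOn]
    have hA := integral_mul_cos_antisymm_nonneg ht htT hT hw.strictMonoOn.monotoneOn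
      hw.continuousOn
    have hB0 : ∀ s ∈ Icc 0 t, 0 ≤ w (T - t + s) * Real.cos (θ * (t - s)) := fun s hs =>
      mul_nonneg (hw.apply_nonneg (hmaps hs)) (hcos s hs)
    have hB := intervalIntegral.integral_nonneg (μ := volume) ht hB0
    have hC : 0 ≤ ∫ s in (0 : ℝ)..t, z s * Real.cos (θ * (t - s)) :=
      intervalIntegral.integral_nonneg ht fun s hs => mul_nonneg (hz.apply_nonneg hs) (hcos s hs)
    rcases htT.lt_or_eq with h | h
    · have := hA.2 h hw.strictMonoOn
      linarith
    · have hB' : 0 < ∫ s in (0 : ℝ)..t, w (T - t + s) * Real.cos (θ * (t - s)) := by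
        refine intervalIntegral.integral_pos (by linarith)
          ((hw.continuousOn.comp hshift hmaps).mul hcosc.continuousOn)
          (fun s hs => hB0 s (Ioc_subset_Icc_self hs)) ⟨t, ⟨ht, le_rfl⟩, ?_⟩
        have : 0 < w (T - t + t) := hw.apply_pos ⟨by linarith, by linarith⟩
        simpa using this
      have := hA.1
      linarith
  have hge : (∫ s in (0 : ℝ)..t, z s ^ (q - 1) * Real.cos (θ * (t - s)))
      ≤ ∫ s in (0 : ℝ)..T, w s ^ (q - 1) * Real.cos (θ * (T - s)) := by
    rw [integral_mul_cos_split ht htT (hw.continuousOn_rpow hq)]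
    have hA := (integral_mul_cos_antisymm_nonneg ht htT hT (hw.monotoneOn_rpow hq)
      (hw.continuousOn_rpow hq)).1
    have hB : (∫ s in (0 : ℝ)..t, z s ^ (q - 1) * Real.cos (θ * (t - s)))
        ≤ ∫ s in (0 : ℝ)..t, w (T - t + s) ^ (q - 1) * Real.cos (θ * (t - s)) := by
      refine intervalIntegral.integral_mono_on ht
        (ContinuousOn.intervalIntegrable (by
          rw [hu]; exact (hz.continuousOn_rpow hq).mul hcosc.continuousOn))
        (ContinuousOn.intervalIntegrable (by
          rw [hu]
          exact ((hw.continuousOn_rpow hq).comp hshift hmaps).mul hcosc.continuousOn))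
        fun s hs => mul_le_mul_of_nonneg_right ?_ (hcos s hs)
      refine Real.rpow_le_rpow (hz.apply_nonneg hs) ?_ (by linarith)
      exact (hw.apply_le_of_neg hκ hT hz hp hs).trans
        (hw.strictMonoOn.monotoneOn ⟨hs.1, hs.2.trans htT⟩ (hmaps hs) (by linarith))
    linarith
  have hκ' := mul_le_mul_of_nonneg_left hge hκ
  by_contra! hlt
  nlinarith

/-- When `κ > 0`, the positive arc carries strictly more `q`-mass than the negative one. -/
theorem QuarterArc.integral_lt (hq : 1 ≤ q) (hκ : 0 < κ) (hT : 0 < T) (ht : 0 < t)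
    (hw : QuarterArc lam κ q p T w w') (hz : QuarterArc lam (-κ) q p t z z') (hp : 0 < p) :
    ∫ s in (0 : ℝ)..t, z s ^ (q - 1) * z s < ∫ s in (0 : ℝ)..T, w s ^ (q - 1) * w s := by
  have htT := hw.le_of_neg hκ.le hT hz
  have hle : ∀ s ∈ Icc 0 t, z s ≤ w s := fun s hs =>
    hw.apply_le_of_neg hκ.le hT hz (Or.inl hp) hs
  have hwt : ∀ s ∈ Icc 0 t, s ∈ Icc 0 T := fun s hs => ⟨hs.1, hs.2.trans htT⟩
  have hcw : ContinuousOn (fun s => w s ^ (q - 1) * w s) (Icc 0 T) :=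
    (hw.continuousOn_rpow hq).mul hw.continuousOn
  have hcz : ContinuousOn (fun s => z s ^ (q - 1) * z s) (Icc 0 t) :=
    (hz.continuousOn_rpow hq).mul hz.continuousOn
  have h1 : ∫ s in (0 : ℝ)..t, w s ^ (q - 1) * w s ≤ ∫ s in (0 : ℝ)..T, w s ^ (q - 1) * w s := by
    rw [← intervalIntegral.integral_add_adjacent_intervals (b := t) (c := T)
      (ContinuousOn.intervalIntegrable (by
        rw [uIcc_of_le ht.le]; exact hcw.mono (Icc_subset_Icc_right htT)))
      (ContinuousOn.intervalIntegrable (by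
        rw [uIcc_of_le htT]; exact hcw.mono (Icc_subset_Icc_left ht.le)))]
    have : 0 ≤ ∫ s in t..T, w s ^ (q - 1) * w s :=
      intervalIntegral.integral_nonneg htT fun s hs => by
        have := hw.apply_nonneg (s := s) ⟨ht.le.trans hs.1, hs.2⟩
        positivity
    linarith
  refine lt_of_lt_of_le ?_ h1
  obtain ⟨c, hc, hlt⟩ : ∃ c ∈ Icc 0 t, z c < w c := by
    by_contra! hcon
    have heq : ∀ s ∈ Icc 0 t, w s = z s := fun s hs => le_antisymm (hcon s hs) (hle s hs)
    have hmid : t / 2 ∈ Ioo 0 t := ⟨by linarith, by linarith⟩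
    have hmid' := Ioo_subset_Icc_self hmid
    have hev : w =ᶠ[nhds (t / 2)] z := by
      filter_upwards [Ioo_mem_nhds hmid.1 hmid.2] with s hs using heq s (Ioo_subset_Icc_self hs)
    have hder : w' (t / 2) = z' (t / 2) :=
      (hw.hasDerivAt _ (hwt _ hmid')).unique
        ((hz.hasDerivAt _ hmid').congr_of_eventuallyEq hev)
    have := wronskian_pos hκ hw hz (s := t / 2) ⟨hmid.1, le_min (hwt _ hmid').2 hmid.2.le⟩
    rw [hder, heq _ hmid'] at this
    linarith
  refine intervalIntegral.integral_lt_integral_of_continuousOn_of_le_of_exists_lt ht hcz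
    (hcw.mono (Icc_subset_Icc_right htT)) (fun s hs => ?_) ⟨c, hc, ?_⟩
  · have hs' := Ioc_subset_Icc_self hs
    have h0 := hz.apply_nonneg hs'
    exact mul_le_mul (Real.rpow_le_rpow h0 (hle s hs') (by linarith)) (hle s hs') h0
      (Real.rpow_nonneg (h0.trans (hle s hs')) _)
  · have h0 := hz.apply_nonneg hc
    have hw0 : 0 < w c := h0.trans_lt hlt
    calc z c ^ (q - 1) * z c ≤ w c ^ (q - 1) * z c :=
          mul_le_mul_of_nonneg_right (Real.rpow_le_rpow h0 hlt.le (by linarith)) h0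
      _ < w c ^ (q - 1) * w c := mul_lt_mul_of_pos_left hlt (Real.rpow_pos_of_pos hw0 _)

end

/-! ### The nonlinear oscillator: energy and arcs -/

section

variable {lam κ q T a b : ℝ} {f f' : ℝ → ℝ}

/-- For `q = 1` the convention `0 ^ 0 = 1` makes `|s| ^ (q - 1) * s` the identity, also at `0`. -/
theorem hasDerivAt_abs_rpow_mul_self (hq : 1 ≤ q) (s : ℝ) :
    HasDerivAt (fun s : ℝ => |s| ^ (q - 1) * s) (q * |s| ^ (q - 1)) s := by
  rcases lt_trichotomy s 0 with hs | hs | hs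
  · have h1 : HasDerivAt (fun s : ℝ => -(-s) ^ q) (q * |s| ^ (q - 1)) s := by
      refine (((hasDerivAt_id s).neg.rpow_const (p := q) (Or.inl (by simp [hs.ne]))).neg).congr_deriv ?_
      rw [abs_of_neg hs]; simp
    refine h1.congr_of_eventuallyEq ?_
    filter_upwards [Iio_mem_nhds hs] with x hx
    have hx' : 0 < -x := neg_pos.2 hx
    rw [abs_of_neg hx]
    have : (-x) ^ q = (-x) ^ (q - 1) * (-x) := by
      rw [← Real.rpow_add_one hx'.ne']; simp
    rw [this]; ring
  · subst hs
    have hval : q * |(0 : ℝ)| ^ (q - 1) = |(0 : ℝ)| ^ (q - 1) := by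
      rcases hq.eq_or_lt with h | h
      · rw [← h]; simp
      · rw [abs_zero, Real.zero_rpow (by linarith)]; simp
    rw [hval, hasDerivAt_iff_tendsto_slope_zero]
    have hc : Continuous fun s : ℝ => |s| ^ (q - 1) :=
      continuous_abs.rpow_const fun _ => Or.inr (by linarith)
    refine ((hc.tendsto 0).mono_left nhdsWithin_le_nhds).congr' ?_
    filter_upwards [self_mem_nhdsWithin] with x hx
    have hx : x ≠ 0 := hx
    simp only [zero_add, mul_zero, sub_zero, smul_eq_mul]
    field_simp
  · have h1 : HasDerivAt (fun s : ℝ => s ^ q) (q * |s| ^ (q - 1)) s := by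
      rw [abs_of_pos hs]
      exact Real.hasDerivAt_rpow_const (Or.inl hs.ne')
    refine h1.congr_of_eventuallyEq ?_
    filter_upwards [Ioi_mem_nhds hs] with x hx
    have hx : 0 < x := hx
    rw [abs_of_pos hx, ← Real.rpow_add_one hx.ne']
    simp

/-- `f`, with derivative `f'`, solves `f'' + lam * f = κ * |f| ^ (q - 1)` on `[a, b]`. -/
structure SolvesOn (lam κ q a b : ℝ) (f f' : ℝ → ℝ) : Prop where
  hasDerivAt : ∀ x ∈ Icc a b, HasDerivAt f (f' x) x
  hasDerivAt_deriv : ∀ x ∈ Icc a b, HasDerivAt f' (κ * |f x| ^ (q - 1) - lam * f x) x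

theorem SolvesOn.mono {c e : ℝ} (h : SolvesOn lam κ q a b f f') (hac : a ≤ c) (heb : e ≤ b) :
    SolvesOn lam κ q c e f f' :=
  ⟨fun x hx => h.hasDerivAt x ⟨hac.trans hx.1, hx.2.trans heb⟩,
    fun x hx => h.hasDerivAt_deriv x ⟨hac.trans hx.1, hx.2.trans heb⟩⟩

theorem SolvesOn.neg (h : SolvesOn lam κ q a b f f') :
    SolvesOn lam (-κ) q a b (fun x => -f x) (fun x => -f' x) :=
  ⟨fun x hx => (h.hasDerivAt x hx).neg, fun x hx =>
    (h.hasDerivAt_deriv x hx).neg.congr_deriv (by rw [abs_neg]; ring)⟩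

theorem SolvesOn.reflect (h : SolvesOn lam κ q a b f f') :
    SolvesOn lam κ q (-b) (-a) (fun x => f (-x)) (fun x => -f' (-x)) := by
  have hm : ∀ x ∈ Icc (-b) (-a), -x ∈ Icc a b := fun x hx =>
    ⟨by linarith [hx.2], by linarith [hx.1]⟩
  refine ⟨fun x hx => ?_, fun x hx => ?_⟩
  · exact ((h.hasDerivAt _ (hm x hx)).scomp x (hasDerivAt_neg x)).congr_deriv (by simp)
  · exact (((h.hasDerivAt_deriv _ (hm x hx)).scomp x (hasDerivAt_neg x)).neg).congr_deriv
      (by simp)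

theorem SolvesOn.continuousOn (h : SolvesOn lam κ q a b f f') : ContinuousOn f (Icc a b) :=
  fun x hx => (h.hasDerivAt x hx).continuousAt.continuousWithinAt

theorem SolvesOn.continuousOn_deriv (h : SolvesOn lam κ q a b f f') : ContinuousOn f' (Icc a b) :=
  fun x hx => (h.hasDerivAt_deriv x hx).continuousAt.continuousWithinAt

/-- Conservation of energy. -/
theorem SolvesOn.energy_eq (hq : 1 ≤ q) (h : SolvesOn lam κ q a b f f') {x x' : ℝ}
    (hx : x ∈ Icc a b) (hx' : x' ∈ Icc a b) :
    f' x ^ 2 + lam * f x ^ 2 - 2 * κ / q * (|f x| ^ (q - 1) * f x)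
      = f' x' ^ 2 + lam * f x' ^ 2 - 2 * κ / q * (|f x'| ^ (q - 1) * f x') := by
  have hq0 : q ≠ 0 := by linarith
  have hd : ∀ x ∈ Icc a b, HasDerivAt
      (fun x => f' x ^ 2 + lam * f x ^ 2 - 2 * κ / q * (|f x| ^ (q - 1) * f x)) 0 x := by
    intro x hx
    have h1 := h.hasDerivAt x hx
    have h2 := h.hasDerivAt_deriv x hx
    have h3 := ((hasDerivAt_abs_rpow_mul_self hq (f x)).comp x h1).const_mul (2 * κ / q)
    refine (((h2.pow 2).add ((h1.pow 2).const_mul lam)).sub h3).congr_deriv ?_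
    field_simp
    ring
  have hlip := (convex_Icc a b).norm_image_sub_le_of_norm_hasDerivWithin_le (C := 0)
    (fun x hx => (hd x hx).hasDerivWithinAt) (fun x _ => by simp) hx' hx
  rw [zero_mul, norm_le_zero_iff, sub_eq_zero] at hlip
  exact hlip

/-- A positive arc issuing from a zero at `a`, read off up to the first critical point. -/
theorem SolvesOn.quarterArc (h : SolvesOn lam κ q a b f f') (ha : f a = 0) (hT : 0 ≤ T)
    (hTb : a + T ≤ b) (hcrit : f' (a + T) = 0) (hpos : ∀ x ∈ Ioo a (a + T), 0 < f' x) :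
    QuarterArc lam κ q (f' a) T (fun s => f (a + s)) (fun s => f' (a + s)) := by
  have hm : ∀ s ∈ Icc 0 T, a + s ∈ Icc a b := fun s hs =>
    ⟨by linarith [hs.1], by linarith [hs.2]⟩
  have hmono : MonotoneOn f (Icc a (a + T)) := by
    have h' := h.mono le_rfl hTb
    refine monotoneOn_of_deriv_nonneg (convex_Icc _ _) h'.continuousOn
      (fun x hx => ?_) (fun x hx => ?_) <;> rw [interior_Icc] at hx
    · exact (h'.hasDerivAt x (Ioo_subset_Icc_self hx)).differentiableAt.differentiableWithinAt
    · rw [(h'.hasDerivAt x (Ioo_subset_Icc_self hx)).deriv]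
      exact (hpos x hx).le
  refine ⟨hT, fun s hs => ?_, fun s hs => ?_, by simpa using ha, by simp, hcrit, fun s hs => ?_⟩
  · exact (h.hasDerivAt _ (hm s hs)).comp_const_add a s
  · have hn : 0 ≤ f (a + s) := by
      rw [← ha]
      exact hmono ⟨le_rfl, by linarith⟩ ⟨by linarith [hs.1], by linarith [hs.2]⟩
        (by linarith [hs.1])
    have := (h.hasDerivAt_deriv _ (hm s hs)).comp_const_add a s
    rwa [abs_of_nonneg hn] at this
  · exact hpos _ ⟨by linarith [hs.1], by linarith [hs.2]⟩

theorem exists_first_zero {g : ℝ → ℝ} (hg : ContinuousOn g (Icc a b)) (ha : 0 < g a) {c : ℝ}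
    (hc : c ∈ Icc a b) (hgc : g c ≤ 0) :
    ∃ e, a < e ∧ e ≤ c ∧ g e = 0 ∧ ∀ x ∈ Ico a e, 0 < g x := by
  have hg' : ContinuousOn g (Icc a c) := hg.mono (Icc_subset_Icc_right hc.2)
  have hcl : IsCompact (Icc a c ∩ g ⁻¹' {0}) :=
    isCompact_Icc.of_isClosed_subset (hg'.preimage_isClosed_of_isClosed isClosed_Icc
      isClosed_singleton) inter_subset_left
  have hne : (Icc a c ∩ g ⁻¹' {0}).Nonempty := by
    obtain ⟨x, hx, hx0⟩ := intermediate_value_Icc' hc.1 hg' ⟨hgc, ha.le⟩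
    exact ⟨x, hx, hx0⟩
  obtain ⟨e, he, hmin⟩ := hcl.exists_isLeast hne
  have he0 : g e = 0 := he.2
  have hae : a < e := lt_of_le_of_ne he.1.1 (by rintro rfl; linarith)
  refine ⟨e, hae, he.1.2, he0, fun x hx => ?_⟩
  by_contra! hneg
  obtain ⟨x', hx', hx0⟩ := intermediate_value_Icc' hx.1
    (hg'.mono (Icc_subset_Icc_right (hx.2.le.trans he.1.2))) ⟨hneg, ha.le⟩
  have := hmin ⟨⟨hx'.1, hx'.2.trans (hx.2.le.trans he.1.2)⟩, hx0⟩
  linarith [hx'.2, hx.2]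

/-- From a zero with positive slope, the solution runs through a full positive arc; its two ends
carry quarter arcs that do not overlap. -/
theorem SolvesOn.exists_arc (hq : 1 ≤ q) (h : SolvesOn lam κ q a b f f') (hab : a < b)
    (ha : f a = 0) (hb : f b = 0) (hp : 0 < f' a) :
    ∃ c t₁ t₂, c ≤ b ∧ 0 < t₁ ∧ 0 < t₂ ∧ t₁ + t₂ ≤ c - a ∧ (∀ x ∈ Icc a c, 0 ≤ f x) ∧
      QuarterArc lam κ q (f' a) t₁ (fun s => f (a + s)) (fun s => f' (a + s)) ∧
      QuarterArc lam κ q (f' a) t₂ (fun s => f (c - s)) (fun s => -f' (c - s)) := by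
  -- the arc is positive on an initial interval `(a, a']`
  obtain ⟨a', haa', ha'b, hpos'⟩ : ∃ a', a < a' ∧ a' < b ∧ ∀ x ∈ Ioc a a', 0 < f x := by
    have hs := (h.hasDerivAt a ⟨le_rfl, hab.le⟩).tendsto_slope_zero_right
    have hev := hs.eventually (lt_mem_nhds hp)
    rw [eventually_nhdsWithin_iff] at hev
    obtain ⟨ε, hε, hball⟩ := Metric.eventually_nhds_iff.1 hev
    refine ⟨a + min (ε / 2) ((b - a) / 2), ?_, ?_, fun x hx => ?_⟩
    · have : 0 < min (ε / 2) ((b - a) / 2) := lt_min (by linarith) (by linarith)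
      linarith
    · have : min (ε / 2) ((b - a) / 2) ≤ (b - a) / 2 := min_le_right _ _
      linarith
    · have h1 : min (ε / 2) ((b - a) / 2) ≤ ε / 2 := min_le_left _ _
      have hx0 : 0 < x - a := by linarith [hx.1]
      have h2 := hball (y := x - a) (by
        rw [Real.dist_eq, sub_zero, abs_of_pos hx0]; linarith [hx.2]) hx0
      rw [ha, sub_zero, add_sub_cancel, smul_eq_mul] at h2
      exact pos_of_mul_pos_right h2 (inv_pos.2 hx0).le
  obtain ⟨c, hac, hcb, hc0, hcpos⟩ := exists_first_zero (a := a') (b := b)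
    (h.continuousOn.mono (Icc_subset_Icc_left haa'.le)) (hpos' a' ⟨haa', le_rfl⟩)
    ⟨ha'b.le, le_rfl⟩ hb.le
  have hac' : a < c := haa'.trans hac
  have hfpos : ∀ x ∈ Ioo a c, 0 < f x := by
    intro x hx
    rcases le_or_gt x a' with hxa | hxa
    · exact hpos' x ⟨hx.1, hxa⟩
    · exact hcpos x ⟨hxa.le, hx.2⟩
  have h' := h.mono le_rfl hcb
  have hcm : c ∈ Icc a b := ⟨hac'.le, hcb⟩
  -- the slope at the right end is opposite to the slope at the left end
  have hslope : f' c = -f' a := by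
    have he := h.energy_eq hq hcm ⟨le_rfl, hab.le⟩
    rw [hc0, ha] at he
    have hle : f' c ≤ 0 := by
      have hs := (h.hasDerivAt c hcm).hasDerivWithinAt (s := Iio c)
      rw [hasDerivWithinAt_iff_tendsto_slope' (by simp)] at hs
      refine le_of_tendsto hs ?_
      filter_upwards [Ioo_mem_nhdsLT hac'] with x hx
      rw [slope_def_field, hc0]
      exact div_nonpos_of_nonneg_of_nonpos (by linarith [hfpos x hx]) (by linarith [hx.2])
    nlinarith
  obtain ⟨m, hm, hm0⟩ := exists_hasDerivAt_eq_zero hac' h'.continuousOn (ha.trans hc0.symm)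
    fun x hx => h'.hasDerivAt x (Ioo_subset_Icc_self hx)
  obtain ⟨e₁, he₁, he₁m, he₁0, he₁pos⟩ := exists_first_zero (a := a) (b := c)
    h'.continuousOn_deriv hp (Ioo_subset_Icc_self hm) hm0.le
  have hr := h'.reflect
  have hp' : 0 < -f' (-(-c)) := by rw [neg_neg, hslope, neg_neg]; exact hp
  obtain ⟨e₂, he₂, he₂m, he₂0, he₂pos⟩ := exists_first_zero (a := -c) (b := -a)
    hr.continuousOn_deriv hp' (c := -m) ⟨by linarith [hm.2], by linarith [hm.1]⟩ (by simp [hm0])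
  have hq1 := h'.quarterArc (T := e₁ - a) ha (by linarith) (by linarith [hm.2])
    (by rw [add_sub_cancel]; exact he₁0)
    (fun x hx => he₁pos x ⟨hx.1.le, by linarith [hx.2]⟩)
  have hq2 := hr.quarterArc (T := e₂ + c) (by simpa using hc0) (by linarith)
    (by linarith [hm.1]) (by
      have : -c + (e₂ + c) = e₂ := by ring
      rw [this]; exact he₂0)
    (fun x hx => he₂pos x ⟨hx.1.le, by linarith [hx.2]⟩)
  refine ⟨c, e₁ - a, e₂ + c, hcb, by linarith, by linarith, by linarith, fun x hx => ?_, hq1, ?_⟩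
  · rcases hx.1.eq_or_lt with hx1 | hx1
    · rw [← hx1, ha]
    rcases hx.2.eq_or_lt with hx2 | hx2
    · rw [hx2, hc0]
    exact (hfpos x ⟨hx1, hx2⟩).le
  · have e1 : (fun s => f (-(-c + s))) = fun s => f (c - s) := by funext s; congr 1; ring
    have e2 : (fun s => -f' (-(-c + s))) = fun s => -f' (c - s) := by
      funext s; congr 2; ring
    rw [e1, e2] at hq2
    simpa [hslope] using hq2

end

/-! ### Solutions with an interior zero -/

section

variable {lam κ q p T t a b d : ℝ} {f f' y v w w' z z' : ℝ → ℝ}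

theorem QuarterArc.one_le_add (hq : 1 ≤ q) (hκ : 0 ≤ κ) (hT : 0 < T)
    (hw : QuarterArc lam κ q p T w w') (hz : QuarterArc lam (-κ) q p t z z')
    (hp : 0 < p ∨ t = 0) (hlam : lam ≤ Real.pi ^ 2) : 1 ≤ T + t := by
  have h := (hw.sq_le hq hκ hT hz hp).trans hlam
  have hl : 0 < T + t := by linarith [hz.nonneg]
  have h2 := le_of_abs_le (abs_le_of_sq_le_sq h Real.pi_pos.le)
  rw [div_le_iff₀ hl] at h2
  nlinarith [Real.pi_pos]

theorem QuarterArc.one_lt_add (hq : 1 ≤ q) (hκ : 0 ≤ κ) (hT : 0 < T)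
    (hw : QuarterArc lam κ q p T w w') (hz : QuarterArc lam (-κ) q p t z z')
    (hp : 0 < p ∨ t = 0) (hlam : lam < Real.pi ^ 2) : 1 < T + t := by
  have h := (hw.sq_le hq hκ hT hz hp).trans_lt hlam
  have hl : 0 < T + t := by linarith [hz.nonneg]
  have h2 := lt_of_pow_lt_pow_left₀ 2 Real.pi_pos.le h
  rw [div_lt_iff₀ hl] at h2
  nlinarith [Real.pi_pos]

/-- The `q`-mass of an arc that is covered by its two quarter arcs. -/
theorem integral_arc_eq {c t₁ t₂ : ℝ} (hq : 1 ≤ q) (hf : ContinuousOn f (Icc a c))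
    (hn : ∀ x ∈ Icc a c, 0 ≤ f x) (h₁ : 0 ≤ t₁) (h₂ : 0 ≤ t₂) (h : t₁ + t₂ = c - a) :
    ∫ x in a..c, |f x| ^ (q - 1) * f x = (∫ s in (0 : ℝ)..t₁, f (a + s) ^ (q - 1) * f (a + s))
      + ∫ s in (0 : ℝ)..t₂, f (c - s) ^ (q - 1) * f (c - s) := by
  have hcont : ContinuousOn (fun x => f x ^ (q - 1) * f x) (Icc a c) :=
    (hf.rpow_const fun _ _ => Or.inr (by linarith)).mul hf
  have h0 : ∫ x in a..c, |f x| ^ (q - 1) * f x = ∫ x in a..c, f x ^ (q - 1) * f x := by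
    apply intervalIntegral.integral_congr
    intro x hx
    rw [uIcc_of_le (by linarith)] at hx
    simp only [abs_of_nonneg (hn x hx)]
  have e1 := intervalIntegral.integral_comp_add_left (fun x => f x ^ (q - 1) * f x) a
    (a := 0) (b := t₁)
  have e2 := intervalIntegral.integral_comp_sub_left (fun x => f x ^ (q - 1) * f x) c
    (a := 0) (b := t₂)
  have e3 : c - t₂ = a + t₁ := by linarith
  rw [add_zero] at e1
  rw [sub_zero, e3] at e2
  rw [h0, e1, e2]
  exact (intervalIntegral.integral_add_adjacent_intervals
    (ContinuousOn.intervalIntegrable (by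
      rw [uIcc_of_le (by linarith)]; exact hcont.mono (Icc_subset_Icc_right (by linarith))))
    (ContinuousOn.intervalIntegrable (by
      rw [uIcc_of_le (by linarith)]; exact hcont.mono (Icc_subset_Icc_left (by linarith))))).symm

/-- A transversal interior zero is surrounded by a positive and a negative arc. -/
theorem SolvesOn.transversal (hq : 1 ≤ q) (h : SolvesOn lam κ q (-1) 1 y v) (hl : y (-1) = 0)
    (hr : y 1 = 0) (hd : d ∈ Ioo (-1 : ℝ) 1) (hd0 : y d = 0) (hv : 0 < v d) :
    Real.pi ^ 2 ≤ lam ∧ (lam = Real.pi ^ 2 → ∫ x in (-1 : ℝ)..1, |y x| ^ (q - 1) * y x = 0 →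
      κ = 0) := by
  obtain ⟨c, t₁, t₂, hc, ht₁, ht₂, hsum, hpos, hw₁, hw₂⟩ :=
    (h.mono hd.1.le le_rfl).exists_arc hq hd.2 hd0 hr hv
  have hneg := h.neg.reflect
  obtain ⟨c', s₁, s₂, hc', hs₁, hs₂, hsum', hpos', hz₁, hz₂⟩ :=
    (hneg.mono (c := -d) (by linarith [hd.2]) le_rfl).exists_arc hq (by linarith [hd.1])
      (by simpa using hd0) (by simpa using hl) (by simpa using hv)
  simp only [neg_neg] at hz₁ hz₂ hsum' hc'
  constructor
  · by_contra! hlam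
    rcases le_total 0 κ with hκ | hκ
    · have h1 := hw₁.one_lt_add hq hκ ht₁ hz₁ (Or.inl hv) hlam
      have h2 := hw₂.one_lt_add hq hκ ht₂ hz₂ (Or.inl hv) hlam
      linarith
    · have hκ' : 0 ≤ -κ := by linarith
      rw [← neg_neg κ] at hw₁ hw₂
      have h1 := hz₁.one_lt_add hq hκ' hs₁ hw₁ (Or.inl hv) hlam
      have h2 := hz₂.one_lt_add hq hκ' hs₂ hw₂ (Or.inl hv) hlam
      linarith
  · intro hlam hint
    by_contra hκ
    have htot : 2 ≤ t₁ + t₂ + (s₁ + s₂) := by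
      rcases le_total 0 κ with hκ | hκ
      · have h1 := hw₁.one_le_add hq hκ ht₁ hz₁ (Or.inl hv) hlam.le
        have h2 := hw₂.one_le_add hq hκ ht₂ hz₂ (Or.inl hv) hlam.le
        linarith
      · have hκ' : 0 ≤ -κ := by linarith
        have hw₁' := hw₁
        have hw₂' := hw₂
        rw [← neg_neg κ] at hw₁' hw₂'
        have h1 := hz₁.one_le_add hq hκ' hs₁ hw₁' (Or.inl hv) hlam.le
        have h2 := hz₂.one_le_add hq hκ' hs₂ hw₂' (Or.inl hv) hlam.le
        linarith
    obtain rfl : c = 1 := by linarith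
    obtain rfl : c' = 1 := by linarith
    have hyc := h.continuousOn
    have i1 := integral_arc_eq hq (hyc.mono (Icc_subset_Icc_left hd.1.le)) hpos ht₁.le ht₂.le
      (by linarith)
    have hnc : ContinuousOn (fun x => -y (-x)) (Icc (-d) 1) := by
      have := hneg.continuousOn
      rw [neg_neg] at this
      exact this.mono (Icc_subset_Icc_left (by linarith [hd.2]))
    have i2 := integral_arc_eq hq hnc hpos' hs₁.le hs₂.le (by linarith)
    have i3 : ∫ x in (-d)..1, |-y (-x)| ^ (q - 1) * -y (-x)
        = -∫ x in (-1 : ℝ)..d, |y x| ^ (q - 1) * y x := by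
      have := intervalIntegral.integral_comp_neg (fun x => |y x| ^ (q - 1) * y x)
        (a := -d) (b := 1)
      rw [neg_neg] at this
      rw [← this, ← intervalIntegral.integral_neg]
      congr 1; funext x; rw [abs_neg]; ring
    have hcont : ContinuousOn (fun x => |y x| ^ (q - 1) * y x) (Icc (-1) 1) :=
      (hyc.abs.rpow_const fun _ _ => Or.inr (by linarith)).mul hyc
    have i4 := intervalIntegral.integral_add_adjacent_intervals (μ := volume)
      (f := fun x => |y x| ^ (q - 1) * y x) (a := -1) (b := d) (c := 1)
      (ContinuousOn.intervalIntegrable (by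
        rw [uIcc_of_le hd.1.le]; exact hcont.mono (Icc_subset_Icc_right hd.2.le)))
      (ContinuousOn.intervalIntegrable (by
        rw [uIcc_of_le hd.2.le]; exact hcont.mono (Icc_subset_Icc_left hd.1.le)))
    rw [i3] at i2
    rcases lt_or_gt_of_ne hκ with hκ | hκ
    · have hκ' : 0 < -κ := by linarith
      rw [← neg_neg κ] at hw₁ hw₂
      have h1 := hz₁.integral_lt hq hκ' hs₁ ht₁ hw₁ hv
      have h2 := hz₂.integral_lt hq hκ' hs₂ ht₂ hw₂ hv
      linarith
    · have h1 := hw₁.integral_lt hq hκ ht₁ hs₁ hz₁ hv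
      have h2 := hw₂.integral_lt hq hκ ht₂ hs₂ hz₂ hv
      linarith

/-- For `q ≤ 2` the function `s ↦ s ^ (q - 1) / s` is nonincreasing. -/
theorem rpow_mul_le_rpow_mul {s M : ℝ} (hq2 : q ≤ 2) (hs : 0 ≤ s) (hsM : s ≤ M) :
    M ^ (q - 1) * s ≤ s ^ (q - 1) * M := by
  rcases hs.eq_or_lt with h | h
  · rw [← h, mul_zero]
    exact mul_nonneg (Real.rpow_nonneg le_rfl _) (hs.trans hsM)
  have hM := h.trans_le hsM
  have e : ∀ x : ℝ, 0 < x → x = x ^ (q - 1) * x ^ (2 - q) := fun x hx => by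
    rw [← Real.rpow_add hx]; norm_num
  calc M ^ (q - 1) * s = s ^ (q - 1) * M ^ (q - 1) * s ^ (2 - q) := by
        conv_lhs => rw [e s h]
        ring
    _ ≤ s ^ (q - 1) * M ^ (q - 1) * M ^ (2 - q) :=
        mul_le_mul_of_nonneg_left (Real.rpow_le_rpow h.le hsM (by linarith)) (by positivity)
    _ = s ^ (q - 1) * M := by
        conv_rhs => rw [e M hM]
        ring

theorem rpow_mul_lt_rpow_mul {s M : ℝ} (hq2 : q < 2) (h : 0 < s) (hsM : s < M) :
    M ^ (q - 1) * s < s ^ (q - 1) * M := by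
  have hM := h.trans hsM
  have e : ∀ x : ℝ, 0 < x → x = x ^ (q - 1) * x ^ (2 - q) := fun x hx => by
    rw [← Real.rpow_add hx]; norm_num
  calc M ^ (q - 1) * s = s ^ (q - 1) * M ^ (q - 1) * s ^ (2 - q) := by
        conv_lhs => rw [e s h]
        ring
    _ < s ^ (q - 1) * M ^ (q - 1) * M ^ (2 - q) :=
        mul_lt_mul_of_pos_left (Real.rpow_lt_rpow h.le hsM (by linarith)) (by positivity)
    _ = s ^ (q - 1) * M := by
        conv_rhs => rw [e M hM]
        ring

theorem SolvesOn.eq_of_deriv_eq_zero (h : SolvesOn lam κ q a b f f') (hab : a ≤ b)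
    (h0 : ∀ x ∈ Icc a b, f' x = 0) : f a = f b := by
  have hlip := (convex_Icc a b).norm_image_sub_le_of_norm_hasDerivWithin_le (C := 0)
    (fun x hx => (h.hasDerivAt x hx).hasDerivWithinAt) (fun x hx => by simp [h0 x hx])
    (right_mem_Icc.2 hab) (left_mem_Icc.2 hab)
  rw [zero_mul, norm_le_zero_iff, sub_eq_zero] at hlip
  exact hlip

/-- The degenerate arc. For `q = 1` its second derivative at `0` is `κ`, not `0`, so the zero function
would not do. -/
theorem exists_quarterArc_zero_length (lam κ q : ℝ) :
    ∃ z z' : ℝ → ℝ, QuarterArc lam κ q 0 0 z z' := by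
  set c := κ * (0 : ℝ) ^ (q - 1) with hc
  refine ⟨fun s => c * (s ^ 2 / 2), fun s => c * s, le_rfl, fun s _ => ?_, fun s hs => ?_,
    by simp, by simp, by simp, fun s hs => absurd (hs.1.trans hs.2) (lt_irrefl _)⟩
  · exact ((((hasDerivAt_id s).pow 2).div_const 2).const_mul c).congr_deriv (by simp)
  · have : s = 0 := le_antisymm hs.2 hs.1
    subst this
    exact ((hasDerivAt_id (0 : ℝ)).const_mul c).congr_deriv (by simp [hc])

/-- If a positive arc that leaves `0` with slope zero reaches its maximum in time less than `1`, then
`lam > π²`: it is a quarter arc, compared here with a negative arc of length zero. -/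
theorem SolvesOn.lt_of_tangent_arc {e m M : ℝ} (hq : 1 ≤ q) (hκ : 0 ≤ κ)
    (h : SolvesOn lam κ q e m f f') (hem : e < m) (hlen : m - e < 1)
    (he : f e = 0) (hm : f m = M) (hM : 0 < M)
    (h0 : ∀ x ∈ Icc e m, f x = 0 → f' x = 0) (hcrit : ∀ x ∈ Icc e m, f x = M → f' x = 0)
    (hne : ∀ x ∈ Icc e m, 0 < f x → f x < M → f' x ≠ 0) : Real.pi ^ 2 < lam := by
  -- the last zero `a` before `m`
  obtain ⟨a, hea, ham, ha0, hapos⟩ : ∃ a, e ≤ a ∧ a < m ∧ f a = 0 ∧ ∀ x ∈ Ioc a m, 0 < f x := by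
    obtain ⟨a', h1, h2, h3, h4⟩ := exists_first_zero h.reflect.continuousOn (c := -e)
      (by simpa [hm] using hM) ⟨by linarith, le_rfl⟩ (by simp [he])
    refine ⟨-a', by linarith, by linarith, h3, fun x hx => ?_⟩
    simpa using h4 (-x) ⟨by linarith [hx.2], by linarith [hx.1]⟩
  -- the first time after `a` at which the maximal value is attained
  have h' := h.mono hea le_rfl
  obtain ⟨e', hae', he'm, he'0, he'pos⟩ := exists_first_zero (g := fun x => M - f x)
    (continuousOn_const.sub h'.continuousOn) (by simpa [ha0] using hM) (c := m)
    ⟨ham.le, le_rfl⟩ (by simp [hm])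
  have hfe' : f e' = M := by linarith
  have hIcc : ∀ x ∈ Ioo a e', x ∈ Icc e m := fun x hx =>
    ⟨hea.trans hx.1.le, hx.2.le.trans he'm⟩
  have hne' : ∀ x ∈ Ioo a e', f' x ≠ 0 := fun x hx =>
    hne x (hIcc x hx) (hapos x ⟨hx.1, hx.2.le.trans he'm⟩)
      (by linarith [he'pos x ⟨hx.1.le, hx.2⟩])
  have hsol := h'.mono le_rfl he'm
  obtain ⟨ξ, hξ, hξ'⟩ := exists_hasDerivAt_eq_slope f f' hae' hsol.continuousOn
    fun x hx => hsol.hasDerivAt x (Ioo_subset_Icc_self hx)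
  have hξpos : 0 < f' ξ := by
    rw [hξ', hfe', ha0, sub_zero]
    exact div_pos hM (by linarith)
  have hpos : ∀ x ∈ Ioo a e', 0 < f' x := by
    intro x hx
    by_contra! hle
    obtain ⟨x₀, hx₀, hx₀'⟩ := isPreconnected_Ioo.intermediate_value hx hξ
      (hsol.continuousOn_deriv.mono Ioo_subset_Icc_self) ⟨hle, hξpos.le⟩
    exact hne' x₀ hx₀ hx₀'
  have harc := h'.quarterArc (T := e' - a) ha0 (by linarith) (by linarith)
    (by rw [add_sub_cancel]; exact hcrit e' ⟨by linarith, he'm⟩ hfe')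
    (fun x hx => hpos x ⟨hx.1, by linarith [hx.2]⟩)
  rw [h0 a ⟨hea, ham.le⟩ ha0] at harc
  obtain ⟨z, z', hz⟩ := exists_quarterArc_zero_length lam (-κ) q
  by_contra! hlam
  have := harc.one_le_add hq hκ (by linarith) hz (Or.inr rfl) hlam
  linarith

/-- A solution with a degenerate interior zero has energy zero, which forces `lam` to be large. -/
theorem SolvesOn.lt_of_degenerate_zero (hq : 1 ≤ q) (hq2 : q ≤ 2) (hκ : 0 ≤ κ)
    (h : SolvesOn lam κ q (-1) 1 y v) (hl : y (-1) = 0) (hr : y 1 = 0)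
    (hd : d ∈ Ioo (-1 : ℝ) 1) (hd0 : y d = 0) (hv : v d = 0)
    (hne : ∃ x ∈ Icc (-1 : ℝ) 1, y x ≠ 0) : Real.pi ^ 2 < lam := by
  set k := 2 * κ / q with hk
  have hk0 : 0 ≤ k := by positivity
  have hE : ∀ x ∈ Icc (-1 : ℝ) 1, v x ^ 2 + lam * y x ^ 2 - k * (|y x| ^ (q - 1) * y x) = 0 := by
    intro x hx
    rw [h.energy_eq hq hx (Ioo_subset_Icc_self hd), hd0, hv]
    simp
  have h0 : ∀ x ∈ Icc (-1 : ℝ) 1, y x = 0 → v x = 0 := by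
    intro x hx hx0
    have := hE x hx
    rw [hx0] at this
    simpa using this
  have hcrit : ∀ m ∈ Icc (-1 : ℝ) 1, y m ≠ 0 → IsExtrOn y (Icc (-1 : ℝ) 1) m → v m = 0 := by
    intro m hm hm0 hext
    have hm' : m ∈ Ioo (-1 : ℝ) 1 :=
      ⟨lt_of_le_of_ne hm.1 (by rintro rfl; exact hm0 hl),
        lt_of_le_of_ne hm.2 (by rintro rfl; exact hm0 hr)⟩
    exact (hext.isLocalExtr (Icc_mem_nhds hm'.1 hm'.2)).hasDerivAt_eq_zero (h.hasDerivAt m hm)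
  have hcomp : (Icc (-1 : ℝ) 1).Nonempty := ⟨0, by simp⟩
  -- at negative values the energy leaves no room for a nonzero slope
  have hnonneg : ∀ x ∈ Icc (-1 : ℝ) 1, 0 ≤ y x := by
    by_contra! hcon
    obtain ⟨x₀, hx₀, hx₀neg⟩ := hcon
    obtain ⟨m, hm, hmin⟩ := isCompact_Icc.exists_isMinOn hcomp h.continuousOn
    have hm0 : y m < 0 := (hmin hx₀).trans_lt hx₀neg
    have hvm := hcrit m hm hm0.ne hmin.isExtr
    have hEm := hE m hm
    rw [hvm, abs_of_neg hm0] at hEm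
    have hlamM : lam * -y m = -(k * (-y m) ^ (q - 1)) := by
      have : (lam * -y m + k * (-y m) ^ (q - 1)) * y m = 0 := by linarith
      rcases mul_eq_zero.1 this with h | h
      · linarith
      · exact absurd h hm0.ne
    have hv0 : ∀ x ∈ Icc (-1 : ℝ) 1, y x ≤ 0 → v x = 0 := by
      intro x hx hx0
      have hEx := hE x hx
      rw [abs_of_nonpos hx0] at hEx
      have hle := rpow_mul_le_rpow_mul (q := q) (s := -y x) (M := -y m) hq2 (by linarith)
        (neg_le_neg (hmin hx))
      have e : v x ^ 2 * -y m
          = -(k * -y x * ((-y x) ^ (q - 1) * -y m - (-y m) ^ (q - 1) * -y x)) := by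
        have e1 : v x ^ 2 = -lam * y x ^ 2 + k * ((-y x) ^ (q - 1) * y x) := by linarith
        have e2 : v x ^ 2 * -y m = -(lam * -y m) * y x ^ 2 + k * ((-y x) ^ (q - 1) * y x) * -y m := by
          rw [e1]; ring
        rw [e2, hlamM]; ring
      have h1 : 0 ≤ k * -y x * ((-y x) ^ (q - 1) * -y m - (-y m) ^ (q - 1) * -y x) :=
        mul_nonneg (mul_nonneg hk0 (by linarith)) (by linarith)
      have h2 : v x ^ 2 ≤ 0 := by
        by_contra! hpos
        nlinarith
      exact pow_eq_zero_iff (two_ne_zero) |>.1 (le_antisymm h2 (sq_nonneg _))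
    obtain ⟨e, hme, he1, he0, hepos⟩ := exists_first_zero (g := fun x => -y x)
      (h.continuousOn.neg.mono (Icc_subset_Icc_left hm.1)) (by linarith) (c := 1)
      ⟨hm.2, le_rfl⟩ (by simp [hr])
    have := (h.mono hm.1 he1).eq_of_deriv_eq_zero hme.le fun x hx => by
      refine hv0 x ⟨hm.1.trans hx.1, hx.2.trans he1⟩ ?_
      rcases hx.2.eq_or_lt with hxe | hxe
      · rw [hxe]; linarith
      · linarith [hepos x ⟨hx.1, hxe⟩]
    linarith
  obtain ⟨m, hm, hmax⟩ := isCompact_Icc.exists_isMaxOn hcomp h.continuousOn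
  set M := y m with hMdef
  have hM : 0 < M := by
    obtain ⟨x, hx, hx0⟩ := hne
    exact (lt_of_le_of_ne (hnonneg x hx) hx0.symm).trans_le (hmax hx)
  have hvm := hcrit m hm hM.ne' hmax.isExtr
  have hEm := hE m hm
  rw [hvm, ← hMdef, abs_of_pos hM] at hEm
  have hlamM : lam * M = k * M ^ (q - 1) := by
    have : (lam * M - k * M ^ (q - 1)) * M = 0 := by linarith
    rcases mul_eq_zero.1 this with h | h
    · linarith
    · exact absurd h hM.ne'
  have hvM : ∀ x ∈ Icc (-1 : ℝ) 1,
      v x ^ 2 * M = k * y x * (y x ^ (q - 1) * M - M ^ (q - 1) * y x) := by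
    intro x hx
    have hEx := hE x hx
    rw [abs_of_nonneg (hnonneg x hx)] at hEx
    have e1 : v x ^ 2 = -lam * y x ^ 2 + k * (y x ^ (q - 1) * y x) := by linarith
    have e2 : v x ^ 2 * M = -(lam * M) * y x ^ 2 + k * (y x ^ (q - 1) * y x) * M := by
      rw [e1]; ring
    rw [e2, hlamM]; ring
  have hvM0 : ∀ x ∈ Icc (-1 : ℝ) 1, v x ^ 2 * M = 0 → v x = 0 := by
    intro x _ h
    rcases mul_eq_zero.1 h with h | h
    · simpa using h
    · exact absurd h hM.ne'
  have hconst : (∀ x ∈ Icc (-1 : ℝ) 1, v x = 0) → False := by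
    intro hz
    have := (h.mono hm.1 le_rfl).eq_of_deriv_eq_zero hm.2 fun x hx =>
      hz x ⟨hm.1.trans hx.1, hx.2⟩
    rw [hr] at this
    linarith
  have hkpos : 0 < k := by
    refine lt_of_le_of_ne hk0 fun hk => hconst fun x hx => hvM0 x hx ?_
    rw [hvM x hx, ← hk]; ring
  have hq2' : q < 2 := by
    refine lt_of_le_of_ne hq2 fun hq => hconst fun x hx => hvM0 x hx ?_
    rw [hvM x hx, hq]
    norm_num
    right; ring
  have hcritM : ∀ x ∈ Icc (-1 : ℝ) 1, y x = M → v x = 0 := by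
    intro x hx hxM
    apply hvM0 x hx
    rw [hvM x hx, hxM]; ring
  have hnev : ∀ x ∈ Icc (-1 : ℝ) 1, 0 < y x → y x < M → v x ≠ 0 := by
    intro x hx hx0 hxM hvx
    have h1 := hvM x hx
    have h2 := rpow_mul_lt_rpow_mul (q := q) hq2' hx0 hxM
    rw [hvx] at h1
    have : 0 < k * y x * (y x ^ (q - 1) * M - M ^ (q - 1) * y x) :=
      mul_pos (mul_pos hkpos hx0) (by linarith)
    linarith
  -- one of the two zeros next to the maximum is at distance less than `1` from it
  obtain ⟨e₁, e₂, he₁, he₂, h₁, h₂, he₁m, he₂m, hlen⟩ : ∃ e₁ e₂, -1 ≤ e₁ ∧ e₂ ≤ 1 ∧ y e₁ = 0 ∧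
      y e₂ = 0 ∧ e₁ < m ∧ m < e₂ ∧ e₂ - e₁ < 2 := by
    have hm1 : -1 < m := lt_of_le_of_ne hm.1 fun hm' => by rw [hMdef, ← hm', hl] at hM; linarith
    have hm2 : m < 1 := lt_of_le_of_ne hm.2 fun hm' => by rw [hMdef, hm', hr] at hM; linarith
    rcases lt_trichotomy d m with hdm | hdm | hdm
    · exact ⟨d, 1, hd.1.le, le_rfl, hd0, hr, hdm, hm2, by linarith [hd.1]⟩
    · rw [hMdef, ← hdm, hd0] at hM; linarith
    · exact ⟨-1, d, le_rfl, hd.2.le, hl, hd0, hm1, hdm, by linarith [hd.2]⟩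
  rcases lt_or_ge (m - e₁) 1 with hlt | hge
  · have hI : ∀ x ∈ Icc e₁ m, x ∈ Icc (-1 : ℝ) 1 := fun x hx =>
      ⟨he₁.trans hx.1, hx.2.trans hm.2⟩
    exact (h.mono he₁ hm.2).lt_of_tangent_arc hq hκ he₁m hlt h₁ rfl hM (fun x hx => h0 x (hI x hx)) (fun x hx => hcritM x (hI x hx))
      fun x hx => hnev x (hI x hx)
  · have hI : ∀ x ∈ Icc (-e₂) (-m), -x ∈ Icc (-1 : ℝ) 1 := fun x hx =>
      ⟨by linarith [hx.2, hm.1], by linarith [hx.1]⟩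
    refine (h.mono hm.1 he₂).reflect.lt_of_tangent_arc (M := M) hq hκ (by linarith) (by linarith)
      (by simpa using h₂) (by simp [hMdef]) hM
      (fun x hx hx0 => ?_) (fun x hx hx0 => ?_) fun x hx hx0 hx1 => ?_
    · rw [h0 _ (hI x hx) hx0, neg_zero]
    · rw [hcritM _ (hI x hx) hx0, neg_zero]
    · exact neg_ne_zero.2 (hnev _ (hI x hx) hx0 hx1)

/-- A nontrivial solution vanishing at `-1`, at `1` and at an interior point has `lam ≥ π²`; in the
limiting case a vanishing `q`-average leaves no room for the nonlinear term. -/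
theorem SolvesOn.pi_sq_le (hq : 1 ≤ q) (hq2 : q ≤ 2)
    (h : SolvesOn lam κ q (-1) 1 y v) (hl : y (-1) = 0) (hr : y 1 = 0)
    (hd : d ∈ Ioo (-1 : ℝ) 1) (hd0 : y d = 0) (hne : ∃ x ∈ Icc (-1 : ℝ) 1, y x ≠ 0) :
    Real.pi ^ 2 ≤ lam ∧ (lam = Real.pi ^ 2 → ∫ x in (-1 : ℝ)..1, |y x| ^ (q - 1) * y x = 0 →
      κ = 0) := by
  rcases lt_trichotomy (v d) 0 with hv | hv | hv
  · have key := h.neg.transversal hq (by simpa using hl) (by simpa using hr) hd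
      (by simpa using hd0) (by linarith)
    refine ⟨key.1, fun hlam hint => ?_⟩
    have := key.2 hlam (by
      rw [← neg_eq_zero, ← hint, ← intervalIntegral.integral_neg]
      congr 1; funext x; rw [abs_neg]; ring)
    linarith
  · have hlt : Real.pi ^ 2 < lam := by
      rcases le_total 0 κ with hκ | hκ
      · exact h.lt_of_degenerate_zero hq hq2 hκ hl hr hd hd0 hv hne
      · exact h.neg.lt_of_degenerate_zero hq hq2 (by linarith) (by simpa using hl)
          (by simpa using hr) hd (by simpa using hd0) (by simpa using hv) (by simpa using hne)
    exact ⟨hlt.le, fun hlam => absurd hlam hlt.ne'⟩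
  · exact h.transversal hq hl hr hd hd0 hv

theorem SolvesOn.exists_eq_sin (h : SolvesOn (Real.pi ^ 2) 0 q (-1) 1 y v) (hl : y (-1) = 0) :
    ∃ c, ∀ x ∈ Icc (-1 : ℝ) 1, y x = c * Real.sin (Real.pi * x) := by
  have hm1 : (-1 : ℝ) ∈ Icc (-1 : ℝ) 1 := by simp
  have hconst : ∀ F : ℝ → ℝ, (∀ x ∈ Icc (-1 : ℝ) 1, HasDerivAt F 0 x) →
      ∀ x ∈ Icc (-1 : ℝ) 1, F x = F (-1) := by
    intro F hF x hx
    have hlip := (convex_Icc (-1 : ℝ) 1).norm_image_sub_le_of_norm_hasDerivWithin_le (C := 0)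
      (fun x hx => (hF x hx).hasDerivWithinAt) (fun x _ => by simp) hm1 hx
    rw [zero_mul, norm_le_zero_iff, sub_eq_zero] at hlip
    exact hlip
  have hlin : ∀ x : ℝ, HasDerivAt (fun x => Real.pi * x) Real.pi x := fun x =>
    ((hasDerivAt_id x).const_mul Real.pi).congr_deriv (by simp)
  have h1 := hconst (fun x => v x * Real.cos (Real.pi * x)
      + Real.pi * (y x * Real.sin (Real.pi * x))) fun x hx => by
    refine (((h.hasDerivAt_deriv x hx).mul (hlin x).cos).add
      (((h.hasDerivAt x hx).mul (hlin x).sin).const_mul Real.pi)).congr_deriv ?_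
    ring
  have h2 := hconst (fun x => v x * Real.sin (Real.pi * x)
      - Real.pi * (y x * Real.cos (Real.pi * x))) fun x hx => by
    refine (((h.hasDerivAt_deriv x hx).mul (hlin x).sin).sub
      (((h.hasDerivAt x hx).mul (hlin x).cos).const_mul Real.pi)).congr_deriv ?_
    ring
  refine ⟨-v (-1) / Real.pi, fun x hx => ?_⟩
  have e1 := h1 x hx
  have e2 := h2 x hx
  simp only [mul_neg, mul_one, Real.cos_neg, Real.cos_pi, Real.sin_neg, Real.sin_pi, neg_zero,
    mul_zero, hl, sub_zero, add_zero] at e1 e2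
  have hpi := Real.pi_ne_zero
  have key : Real.pi * y x = -v (-1) * Real.sin (Real.pi * x) := by
    have hsc := Real.sin_sq_add_cos_sq (Real.pi * x)
    linear_combination Real.sin (Real.pi * x) * e1 - Real.cos (Real.pi * x) * e2
      - Real.pi * y x * hsc
  field_simp
  linarith

end

/-! ### The Euler–Lagrange equation -/

section

variable {α μ q : ℝ} {g h y η : ℝ → ℝ}

/-- `g` is in `L²(-1, 1)` and has mean zero; the primitives of these functions are exactly the
elements of `H¹₀(-1, 1)`. -/
def MeanZero (g : ℝ → ℝ) : Prop := MemLp g 2 vol ∧ prim g 1 = 0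

theorem MeanZero.integrable (hg : MeanZero g) : Integrable g vol := integrable_of_memLp hg.1

theorem MeanZero.continuous_prim (hg : MeanZero g) : Continuous (prim g) :=
  NonlocalEigenvalue.continuous_prim hg.integrable

theorem MeanZero.add_const_mul (hg : MeanZero g) (hh : MeanZero h) (t : ℝ) :
    MeanZero (fun x => g x + t * h x) := by
  refine ⟨hg.1.add (hh.1.const_mul t), ?_⟩
  rw [prim_add hg.integrable (hh.integrable.const_mul t), prim_const_mul, hg.2, hh.2]
  ring

theorem MeanZero.prim_add_const_mul (hg : MeanZero g) (hh : MeanZero h) (t : ℝ) :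
    prim (fun x => g x + t * h x) = fun x => prim g x + t * prim h x := by
  funext x
  rw [prim_add hg.integrable (hh.integrable.const_mul t), prim_const_mul]

theorem qAverage_eq (q : ℝ) (u : ℝ → ℝ) :
    qAverage q u = ∫ x, |u x| ^ (q - 1) * u x ∂vol :=
  integral_eq_integral_vol _

theorem qAverage_congr {u v : ℝ → ℝ} (h : u =ᵐ[vol] v) : qAverage q u = qAverage q v := by
  rw [qAverage_eq, qAverage_eq]
  apply integral_congr_ae
  filter_upwards [h] with x hx
  rw [hx]

theorem hasDerivAt_qAverage (hq : 1 ≤ q) (hy : Continuous y) (hη : Continuous η) :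
    HasDerivAt (fun t => qAverage q (fun x => y x + t * η x))
      (q * ∫ x, |y x| ^ (q - 1) * η x ∂vol) 0 := by
  have hq1 : 0 ≤ q - 1 := by linarith
  have hpow : Continuous fun s : ℝ => |s| ^ (q - 1) :=
    continuous_abs.rpow_const fun _ => Or.inr hq1
  obtain ⟨C₁, hC₁⟩ := isCompact_Icc.exists_bound_of_continuousOn (s := Icc (-1 : ℝ) 1) hy.continuousOn
  obtain ⟨C₂, hC₂⟩ := isCompact_Icc.exists_bound_of_continuousOn (s := Icc (-1 : ℝ) 1) hη.continuousOn
  have h0 : (0 : ℝ) ∈ Icc (-1 : ℝ) 1 := by simp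
  have hC₁0 : 0 ≤ C₁ := (norm_nonneg _).trans (hC₁ 0 h0)
  have hC₂0 : 0 ≤ C₂ := (norm_nonneg _).trans (hC₂ 0 h0)
  have key := (hasDerivAt_integral_of_dominated_loc_of_deriv_le (μ := vol) (x₀ := (0 : ℝ))
    (F := fun t x => |y x + t * η x| ^ (q - 1) * (y x + t * η x))
    (F' := fun t x => q * |y x + t * η x| ^ (q - 1) * η x)
    (bound := fun _ => q * (C₁ + C₂) ^ (q - 1) * C₂) (Metric.ball_mem_nhds 0 one_pos)
    (Filter.Eventually.of_forall fun t => ?_) ?_ ?_ ?_ (integrable_const _) ?_).2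
  · simp only [zero_mul, add_zero] at key
    simp_rw [qAverage_eq]
    refine key.congr_deriv ?_
    rw [← integral_const_mul]
    congr 1; funext x; ring
  · have : Continuous fun x => y x + t * η x := by fun_prop
    exact ((hpow.comp this).mul this).aestronglyMeasurable
  · simp only [zero_mul, add_zero]
    exact integrable_of_continuous ((hpow.comp hy).mul hy)
  · simp only [zero_mul, add_zero]
    exact ((continuous_const.mul (hpow.comp hy)).mul hη).aestronglyMeasurable
  · refine ae_vol_of_forall_Icc fun x hx t ht => ?_
    rw [Metric.mem_ball, Real.dist_eq, sub_zero] at ht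
    have h1 := hC₁ x hx
    have h2 := hC₂ x hx
    rw [Real.norm_eq_abs] at h1 h2
    have h3 : |y x + t * η x| ≤ C₁ + C₂ := by
      refine (abs_add_le _ _).trans (add_le_add h1 ?_)
      rw [abs_mul]
      nlinarith [abs_nonneg t, abs_nonneg (η x)]
    rw [Real.norm_eq_abs, abs_mul, abs_mul, abs_of_nonneg (by linarith : (0 : ℝ) ≤ q),
      abs_of_nonneg (by positivity : 0 ≤ |y x + t * η x| ^ (q - 1))]
    have h4 : |y x + t * η x| ^ (q - 1) ≤ (C₁ + C₂) ^ (q - 1) :=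
      Real.rpow_le_rpow (abs_nonneg _) h3 hq1
    gcongr
  · refine Filter.Eventually.of_forall fun x t _ => ?_
    have h1 : HasDerivAt (fun t => y x + t * η x) (η x) t :=
      (((hasDerivAt_id t).mul_const (η x)).const_add (y x)).congr_deriv (by simp)
    exact (hasDerivAt_abs_rpow_mul_self hq _).comp t h1

/-- At a critical point of `A` the power `|A| ^ r` is differentiable even if `A` vanishes and
`r = 1`. -/
theorem hasDerivAt_abs_rpow_of_deriv_zero {A : ℝ → ℝ} {r t : ℝ} (hr : 1 ≤ r)
    (hA : HasDerivAt A 0 t) : HasDerivAt (fun t => |A t| ^ r) 0 t := by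
  have h1 : HasDerivAt (fun t => |A t|) 0 t := by
    rw [hasDerivAt_iff_isLittleO] at hA ⊢
    refine (Asymptotics.IsBigO.of_bound 1 (Filter.Eventually.of_forall fun x => ?_)).trans_isLittleO hA
    simpa using abs_abs_sub_abs_le (A x) (A t)
  simpa using h1.rpow_const (p := r) (Or.inr hr)

/-- The numerator of the quotient minus `μ` times its denominator, at the primitive of `g`. -/
def gap (α q μ : ℝ) (g : ℝ → ℝ) : ℝ :=
  (∫ x, g x ^ 2 ∂vol) + α * |qAverage q (prim g)| ^ (2 / q) - μ * ∫ x, prim g x ^ 2 ∂vol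

/-- Variations that do not change the `q`-average to first order see only the linear part of the
functional. This is true also where the `q`-average vanishes and `q = 2`, although the absolute value
of the `q`-average is not differentiable there. -/
theorem euler_lagrange_of_constraint (hq : 1 ≤ q) (hq2 : q ≤ 2) (hg : MeanZero g)
    (hmin : ∀ h, MeanZero h → 0 ≤ gap α q μ h) (hzero : gap α q μ g = 0) (hh : MeanZero h)
    (hl : ∫ x, |prim g x| ^ (q - 1) * prim h x ∂vol = 0) :
    (∫ x, g x * h x ∂vol) - μ * ∫ x, prim g x * prim h x ∂vol = 0 := by
  have hA := hasDerivAt_qAverage hq hg.continuous_prim hh.continuous_prim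
  rw [hl, mul_zero] at hA
  have hB := hasDerivAt_abs_rpow_of_deriv_zero (r := 2 / q)
    (by rw [le_div_iff₀ (by linarith)]; linarith) hA
  set a := ∫ x, g x * h x ∂vol
  set b := ∫ x, prim g x * prim h x ∂vol
  have hexp : ∀ t, gap α q μ (fun x => g x + t * h x)
      = ((∫ x, g x ^ 2 ∂vol) + 2 * t * a + t ^ 2 * ∫ x, h x ^ 2 ∂vol)
        + α * |qAverage q (fun x => prim g x + t * prim h x)| ^ (2 / q)
        - μ * ((∫ x, prim g x ^ 2 ∂vol) + 2 * t * b + t ^ 2 * ∫ x, prim h x ^ 2 ∂vol) := by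
    intro t
    rw [gap, hg.prim_add_const_mul hh, integral_add_mul_sq hg.1 hh.1,
      integral_add_mul_sq (memLp_prim hg.integrable) (memLp_prim hh.integrable)]
  have hpoly : ∀ c₀ c₁ c₂ : ℝ, HasDerivAt (fun t : ℝ => c₀ + 2 * t * c₁ + t ^ 2 * c₂) (2 * c₁) 0 := by
    intro c₀ c₁ c₂
    refine (((((hasDerivAt_id (0 : ℝ)).const_mul 2).mul_const c₁).const_add c₀).add
      (((hasDerivAt_id (0 : ℝ)).pow 2).mul_const c₂)).congr_deriv ?_
    simp
  have hd : HasDerivAt (fun t => gap α q μ (fun x => g x + t * h x))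
      (2 * a + α * 0 - μ * (2 * b)) 0 := by
    simp_rw [hexp]
    exact ((hpoly _ _ _).add (hB.const_mul α)).sub ((hpoly _ _ _).const_mul μ)
  have hloc : IsLocalMin (fun t => gap α q μ (fun x => g x + t * h x)) 0 := by
    refine Filter.Eventually.of_forall fun t => ?_
    simp only [zero_mul, add_zero]
    have e : gap α q μ (fun x => g x) = 0 := hzero
    rw [e]
    exact hmin _ (hg.add_const_mul hh t)
  have := hloc.hasDerivAt_eq_zero hd
  linarith

/-- The Euler–Lagrange equation in weak form. -/
theorem exists_euler_lagrange (hq : 1 ≤ q) (hq2 : q ≤ 2) (hg : MeanZero g)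
    (hmin : ∀ h, MeanZero h → 0 ≤ gap α q μ h) (hzero : gap α q μ g = 0) :
    ∃ κ : ℝ, ∀ h, MeanZero h → ∫ x, g x * h x ∂vol
      = -∫ x, prim h x * (κ * |prim g x| ^ (q - 1) - μ * prim g x) ∂vol := by
  have hpow : Continuous fun x => |prim g x| ^ (q - 1) :=
    hg.continuous_prim.abs.rpow_const fun _ => Or.inr (by linarith)
  have hsplit : ∀ (κ : ℝ) (h : ℝ → ℝ), MeanZero h →
      ∫ x, prim h x * (κ * |prim g x| ^ (q - 1) - μ * prim g x) ∂vol
        = κ * (∫ x, |prim g x| ^ (q - 1) * prim h x ∂vol)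
          - μ * ∫ x, prim g x * prim h x ∂vol := by
    intro κ h hh
    have h1 : Integrable (fun x => |prim g x| ^ (q - 1) * prim h x) vol :=
      integrable_of_continuous (hpow.mul hh.continuous_prim)
    have h2 : Integrable (fun x => prim g x * prim h x) vol :=
      integrable_of_continuous (hg.continuous_prim.mul hh.continuous_prim)
    rw [← integral_const_mul, ← integral_const_mul,
      ← integral_sub (h1.const_mul κ) (h2.const_mul μ)]
    congr 1; funext x; ring
  by_cases hex : ∃ h₀, MeanZero h₀ ∧ ∫ x, |prim g x| ^ (q - 1) * prim h₀ x ∂vol ≠ 0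
  · obtain ⟨h₀, hh₀, hl₀⟩ := hex
    set l₀ := ∫ x, |prim g x| ^ (q - 1) * prim h₀ x ∂vol with hl₀def
    set L₀ := (∫ x, g x * h₀ x ∂vol) - μ * ∫ x, prim g x * prim h₀ x ∂vol with hL₀
    refine ⟨-(L₀ / l₀), fun h hh => ?_⟩
    rw [hsplit _ h hh]
    set l := ∫ x, |prim g x| ^ (q - 1) * prim h x ∂vol with hl
    have hadd : ∀ (F G H : ℝ → ℝ) (t : ℝ), Integrable (fun x => F x * G x) vol →
        Integrable (fun x => F x * H x) vol → ∫ x, F x * (G x + t * H x) ∂vol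
          = (∫ x, F x * G x ∂vol) + t * ∫ x, F x * H x ∂vol := by
      intro F G H t h1 h2
      rw [← integral_const_mul, ← integral_add h1 (h2.const_mul t)]
      congr 1; funext x; ring
    have key := euler_lagrange_of_constraint hq hq2 hg hmin hzero
      (hh.add_const_mul hh₀ (-(l / l₀))) (by
        rw [hh.prim_add_const_mul hh₀, hadd _ _ _ _
          (integrable_of_continuous (hpow.mul hh.continuous_prim))
          (integrable_of_continuous (hpow.mul hh₀.continuous_prim)), ← hl, ← hl₀def]
        field_simp
        ring)
    rw [hh.prim_add_const_mul hh₀, hadd _ _ _ _ (hg.1.integrable_mul hh.1)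
      (hg.1.integrable_mul hh₀.1), hadd _ _ _ _
      (integrable_of_continuous (hg.continuous_prim.mul hh.continuous_prim))
      (integrable_of_continuous (hg.continuous_prim.mul hh₀.continuous_prim))] at key
    have e : L₀ / l₀ * l = l / l₀ * L₀ := by ring
    have : -(-(L₀ / l₀) * l) = l / l₀ * L₀ := by rw [← e]; ring
    rw [neg_sub, sub_eq_add_neg, this, hL₀]
    linarith
  · push Not at hex
    refine ⟨0, fun h hh => ?_⟩
    rw [hsplit _ h hh]
    have := euler_lagrange_of_constraint hq hq2 hg hmin hzero hh (hex h hh)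
    linarith

/-- Regularity: the weak equation, tested against mean-zero derivatives, makes `prim g` a classical
solution. -/
theorem exists_solvesOn (hq : 1 ≤ q) (hq2 : q ≤ 2) (hg : MeanZero g)
    (hmin : ∀ h, MeanZero h → 0 ≤ gap α q μ h) (hzero : gap α q μ g = 0) :
    ∃ κ y v, SolvesOn μ κ q (-1) 1 y v ∧ ∀ x ∈ Icc (-1 : ℝ) 1, y x = prim g x := by
  obtain ⟨κ, hEL⟩ := exists_euler_lagrange hq hq2 hg hmin hzero
  set F : ℝ → ℝ := fun x => κ * |prim g x| ^ (q - 1) - μ * prim g x with hF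
  have hFc : Continuous F :=
    (continuous_const.mul (hg.continuous_prim.abs.rpow_const fun _ => Or.inr (by linarith))).sub
      (continuous_const.mul hg.continuous_prim)
  set Φ : ℝ → ℝ := fun x => ∫ t in (-1 : ℝ)..x, F t with hΦ
  have hΦd : ∀ x, HasDerivAt Φ (F x) x := fun x =>
    intervalIntegral.integral_hasDerivAt_right (hFc.intervalIntegrable _ _)
      (hFc.stronglyMeasurableAtFilter _ _) hFc.continuousAt
  have hΦc : Continuous Φ := continuous_iff_continuousAt.2 fun x => (hΦd x).continuousAt
  have hΦ2 : MemLp Φ 2 vol := memLp_of_continuous hΦc 2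
  have horth : ∀ h, MeanZero h → ∫ x, (g x - Φ x) * h x ∂vol = 0 := by
    intro h hh
    have h1 := hEL h hh
    rw [integral_prim_mul_deriv hh.integrable hΦd hFc, hh.2] at h1
    have h2 : Integrable (fun x => g x * h x) vol := hg.1.integrable_mul hh.1
    have h3 : Integrable (fun x => h x * Φ x) vol := hh.1.integrable_mul hΦ2
    have h4 : ∫ x, (g x - Φ x) * h x ∂vol = (∫ x, g x * h x ∂vol) - ∫ x, h x * Φ x ∂vol := by
      rw [← integral_sub h2 h3]
      congr 1; funext x; ring
    rw [h4, h1]; ring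
  -- subtracting its mean from `g - Φ` gives an admissible variation orthogonal to itself
  set c := (∫ x, (g x - Φ x) ∂vol) / 2 with hc
  have hdiff : MemLp (fun x => g x - Φ x) 2 vol := hg.1.sub hΦ2
  have hcm : MemLp (fun _ : ℝ => c) 2 vol := memLp_const c
  have hh : MeanZero (fun x => g x - Φ x - c) := by
    refine ⟨hdiff.sub hcm, ?_⟩
    rw [prim_one, integral_sub (integrable_of_memLp hdiff) (integrable_const c), integral_const,
      vol_real_univ, smul_eq_mul, hc]
    ring
  have hsq : ∫ x, (g x - Φ x - c) ^ 2 ∂vol = 0 := by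
    have h1 := horth _ hh
    have h2 : ∫ x, (g x - Φ x - c) ∂vol = 0 := by rw [← prim_one]; exact hh.2
    have h3 : Integrable (fun x => (g x - Φ x) * (g x - Φ x - c)) vol := hdiff.integrable_mul hh.1
    have h4 : ∀ x, (g x - Φ x - c) ^ 2
        = (g x - Φ x) * (g x - Φ x - c) - c * (g x - Φ x - c) := fun x => by ring
    simp_rw [h4]
    rw [integral_sub h3 (hh.integrable.const_mul c), integral_const_mul, h1, h2]
    ring
  rw [integral_eq_zero_iff_of_nonneg (fun x => sq_nonneg _) hh.1.integrable_sq] at hsq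
  set v : ℝ → ℝ := fun x => Φ x + c with hv
  have hgv : g =ᵐ[vol] v := by
    filter_upwards [hsq] with x hx
    have : g x - Φ x - c = 0 := by simpa using hx
    simp only [hv]; linarith
  have hvc : Continuous v := hΦc.add continuous_const
  have hy : ∀ x ∈ Icc (-1 : ℝ) 1, ∫ t in (-1 : ℝ)..x, v t = prim g x := by
    intro x hx
    rw [prim_congr hgv, prim_eq_intervalIntegral v hx]
  refine ⟨κ, fun x => ∫ t in (-1 : ℝ)..x, v t, v, ⟨fun x _ => ?_, fun x hx => ?_⟩, hy⟩
  · exact intervalIntegral.integral_hasDerivAt_right (hvc.intervalIntegrable _ _)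
      (hvc.stronglyMeasurableAtFilter _ _) hvc.continuousAt
  · rw [hy x hx]
    exact (hΦd x).add_const c

end

/-! ### Existence of minimizers -/

section

variable {α μ q : ℝ} {g : ℝ → ℝ}

/-- Bounded sequences in `L²(-1, 1)` have weakly convergent subsequences. -/
theorem exists_subseq_tendsto_integral_mul {G : ℕ → ℝ → ℝ} {C : ℝ} (hG : ∀ n, MemLp (G n) 2 vol)
    (hC : ∀ n, ∫ x, G n x ^ 2 ∂vol ≤ C) :
    ∃ φ : ℕ → ℕ, StrictMono φ ∧ ∃ g, MemLp g 2 vol ∧ ∀ h, MemLp h 2 vol →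
      Filter.Tendsto (fun n => ∫ x, G (φ n) x * h x ∂vol) Filter.atTop
        (nhds (∫ x, g x * h x ∂vol)) := by
  have : Fact ((2 : ENNReal) ≠ ⊤) := ⟨by norm_num⟩
  let V := Lp ℝ 2 vol
  have hinner : ∀ (f k : ℝ → ℝ) (hf : MemLp f 2 vol) (hk : MemLp k 2 vol),
      inner ℝ (hf.toLp f) (hk.toLp k) = ∫ x, f x * k x ∂vol := by
    intro f k hf hk
    rw [L2.inner_def]
    apply integral_congr_ae
    filter_upwards [hf.coeFn_toLp, hk.coeFn_toLp] with x h1 h2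
    rw [h1, h2]
    simp [mul_comm]
  let ℓ : ℕ → WeakDual ℝ V := fun n =>
    StrongDual.toWeakDual (InnerProductSpace.toDual ℝ V ((hG n).toLp (G n)))
  have hmem : ∀ n, ℓ n ∈ WeakDual.toStrongDual ⁻¹' Metric.closedBall (0 : StrongDual ℝ V) (√C) := by
    intro n
    rw [mem_preimage, mem_closedBall_zero_iff]
    have h1 : ‖(InnerProductSpace.toDual ℝ V ((hG n).toLp (G n)))‖ ≤ √C := by
      rw [LinearIsometryEquiv.norm_map]
      apply Real.le_sqrt_of_sq_le
      rw [← real_inner_self_eq_norm_sq, hinner _ _ (hG n) (hG n)]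
      simpa [sq] using hC n
    exact h1
  obtain ⟨L, -, φ, hφ, hlim⟩ := WeakDual.isSeqCompact_closedBall ℝ V 0 (√C) hmem
  let γ : V := (InnerProductSpace.toDual ℝ V).symm (WeakDual.toStrongDual L)
  refine ⟨φ, hφ, γ, Lp.memLp γ, fun h hh => ?_⟩
  have h1 := (WeakDual.eval_continuous (𝕜 := ℝ) (hh.toLp h)).tendsto L |>.comp hlim
  have h2 : ∀ n, (ℓ (φ n)) (hh.toLp h) = ∫ x, G (φ n) x * h x ∂vol := fun n =>
    (InnerProductSpace.toDual_apply_apply (𝕜 := ℝ)).trans (hinner _ _ (hG (φ n)) hh)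
  have h3 : L (hh.toLp h) = ∫ x, γ x * h x ∂vol := by
    have h4 : inner ℝ γ (hh.toLp h) = (WeakDual.toStrongDual L) (hh.toLp h) :=
      InnerProductSpace.toDual_symm_apply
    have h5 := hinner γ h (Lp.memLp γ) hh
    rw [Lp.toLp_coeFn] at h5
    rw [← h5, h4]
    rfl
  rw [← h3]
  exact h1.congr h2

theorem MeanZero.const_mul (hg : MeanZero g) (c : ℝ) : MeanZero (fun x => c * g x) :=
  ⟨hg.1.const_mul c, by rw [prim_const_mul, hg.2, mul_zero]⟩

theorem abs_rpow_qAverage_const_mul (hq : 1 ≤ q) {c : ℝ} (hc : 0 < c) (y : ℝ → ℝ) :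
    |qAverage q (fun x => c * y x)| ^ (2 / q) = c ^ 2 * |qAverage q y| ^ (2 / q) := by
  have hq0 : q ≠ 0 := by linarith
  have h1 : qAverage q (fun x => c * y x) = c ^ q * qAverage q y := by
    rw [qAverage_eq, qAverage_eq, ← integral_const_mul]
    congr 1; funext x
    have : c ^ q = c ^ (q - 1) * c := by rw [← Real.rpow_add_one hc.ne']; simp
    rw [abs_mul, abs_of_pos hc, Real.mul_rpow hc.le (abs_nonneg _), this]
    ring
  rw [h1, abs_mul, abs_of_pos (Real.rpow_pos_of_pos hc q),
    Real.mul_rpow (Real.rpow_nonneg hc.le _) (abs_nonneg _), ← Real.rpow_mul hc.le,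
    mul_div_cancel₀ _ hq0, Real.rpow_two]

theorem gap_const_mul (hq : 1 ≤ q) {c : ℝ} (hc : 0 < c) (g : ℝ → ℝ) :
    gap α q μ (fun x => c * g x) = c ^ 2 * gap α q μ g := by
  have h1 : prim (fun x => c * g x) = fun x => c * prim g x := funext (prim_const_mul c g)
  simp only [gap, h1, abs_rpow_qAverage_const_mul hq hc, mul_pow, integral_const_mul]
  ring

theorem qAverage_zero (q : ℝ) : qAverage q (fun _ => 0) = 0 := by
  simp [qAverage]

theorem gap_nonneg_of_prim_eq_zero (hq : 1 ≤ q) (h : prim g =ᵐ[vol] 0) : 0 ≤ gap α q μ g := by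
  have h1 : qAverage q (prim g) = 0 := (qAverage_congr h).trans (qAverage_zero q)
  have h2 : ∫ x, prim g x ^ 2 ∂vol = 0 := by
    rw [integral_eq_zero_of_ae]
    filter_upwards [h] with x hx
    simp [hx]
  have h3 : (2 / q : ℝ) ≠ 0 := by positivity
  rw [gap, h1, h2, abs_zero, Real.zero_rpow h3]
  have : 0 ≤ ∫ x, g x ^ 2 ∂vol := integral_nonneg fun x => sq_nonneg _
  linarith

theorem integral_prim_sq_pos (hg : MeanZero g) (h : ¬ prim g =ᵐ[vol] 0) :
    0 < ∫ x, prim g x ^ 2 ∂vol := by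
  refine lt_of_le_of_ne (integral_nonneg fun x => sq_nonneg _) fun h0 => h ?_
  rw [eq_comm, integral_eq_zero_iff_of_nonneg (fun x => sq_nonneg _)
    (memLp_prim hg.integrable).integrable_sq] at h0
  filter_upwards [h0] with x hx
  simpa using hx

/-- The direct method: for `α ≥ 0` the infimum is attained. Weak convergence of the derivatives gives
pointwise bounded convergence of the functions. -/
theorem exists_minimizer (hq : 1 ≤ q) (hα : 0 ≤ α) (hne : ∃ h, MeanZero h ∧ ¬ prim h =ᵐ[vol] 0) :
    ∃ g μ, MeanZero g ∧ ∫ x, prim g x ^ 2 ∂vol = 1 ∧ gap α q μ g = 0 ∧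
      ∀ h, MeanZero h → 0 ≤ gap α q μ h := by
  set N : (ℝ → ℝ) → ℝ := fun h => (∫ x, h x ^ 2 ∂vol) + α * |qAverage q (prim h)| ^ (2 / q) with hN
  have hgap : ∀ μ h, gap α q μ h = N h - μ * ∫ x, prim h x ^ 2 ∂vol := fun μ h => rfl
  set S : Set ℝ := {r | ∃ h, MeanZero h ∧ ∫ x, prim h x ^ 2 ∂vol = 1 ∧ r = N h} with hS
  have hnorm : ∀ h, MeanZero h → ¬ prim h =ᵐ[vol] 0 → ∃ c : ℝ, 0 < c ∧
      ∫ x, prim (fun x => c * h x) x ^ 2 ∂vol = 1 := by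
    intro h hh h0
    have hD := integral_prim_sq_pos hh h0
    refine ⟨(√(∫ x, prim h x ^ 2 ∂vol))⁻¹, inv_pos.2 (Real.sqrt_pos.2 hD), ?_⟩
    simp_rw [prim_const_mul, mul_pow, inv_pow, Real.sq_sqrt hD.le]
    rw [integral_const_mul, inv_mul_cancel₀ hD.ne']
  have hSne : S.Nonempty := by
    obtain ⟨h, hh, h0⟩ := hne
    obtain ⟨c, -, hc1⟩ := hnorm h hh h0
    exact ⟨_, _, hh.const_mul c, hc1, rfl⟩
  have hterm : ∀ h : ℝ → ℝ, 0 ≤ α * |qAverage q (prim h)| ^ (2 / q) := fun h => by positivity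
  have hSbdd : BddBelow S := by
    refine ⟨0, ?_⟩
    rintro r ⟨h, -, -, rfl⟩
    exact add_nonneg (integral_nonneg fun x => sq_nonneg _) (hterm h)
  set μ := sInf S with hμ
  have hmin : ∀ h, MeanZero h → 0 ≤ gap α q μ h := by
    intro h hh
    by_cases h0 : prim h =ᵐ[vol] 0
    · exact gap_nonneg_of_prim_eq_zero hq h0
    · obtain ⟨c, hc, hc1⟩ := hnorm h hh h0
      have h1 : μ ≤ N (fun x => c * h x) := csInf_le hSbdd ⟨_, hh.const_mul c, hc1, rfl⟩
      have h2 := gap_const_mul (α := α) (μ := μ) hq hc h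
      rw [hgap, hc1] at h2
      have h3 : 0 ≤ c ^ 2 * gap α q μ h := by linarith
      exact nonneg_of_mul_nonneg_right h3 (by positivity)
  obtain ⟨r, hrmono, hrlim, hrS⟩ := exists_seq_tendsto_sInf hSne hSbdd
  choose G hG hG1 hGN using hrS
  have hNle : ∀ n, ∫ x, G n x ^ 2 ∂vol ≤ r 0 := fun n => by
    have h1 : r n ≤ r 0 := hrmono (Nat.zero_le n)
    have h2 := hterm (G n)
    rw [hGN n] at h1
    simp only [hN] at h1 ⊢
    linarith
  obtain ⟨φ, hφ, g, hg, hweak⟩ := exists_subseq_tendsto_integral_mul (fun n => (hG n).1) hNle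
  have hpt : ∀ x, Filter.Tendsto (fun n => prim (G (φ n)) x) Filter.atTop (nhds (prim g x)) := by
    intro x
    have := hweak ((Iic x).indicator fun _ => (1 : ℝ))
      ((memLp_const 1).indicator measurableSet_Iic)
    simp_rw [prim_eq_integral_indicator, mul_comm ((Iic x).indicator _ _)]
    exact this
  have hgm : MeanZero g := by
    refine ⟨hg, tendsto_nhds_unique (hpt 1) ?_⟩
    simp_rw [(hG (φ _)).2]
    exact tendsto_const_nhds
  have hbound : ∀ n, ∀ x ∈ Icc (-1 : ℝ) 1, |prim (G n) x| ≤ √(2 * r 0) := by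
    intro n x hx
    apply Real.abs_le_sqrt
    have := sq_prim_le (hG n).1 hx
    linarith [hNle n]
  have hsq : ∫ x, prim g x ^ 2 ∂vol = 1 := by
    have h1 := tendsto_integral_of_dominated_convergence (μ := vol)
      (F := fun n x => prim (G (φ n)) x ^ 2) (f := fun x => prim g x ^ 2)
      (fun _ => √(2 * r 0) ^ 2)
      (fun n => ((hG (φ n)).continuous_prim.pow 2).aestronglyMeasurable) (integrable_const _)
      (fun n => ae_vol_of_forall_Icc fun x hx => by
        rw [norm_pow, Real.norm_eq_abs]
        exact pow_le_pow_left₀ (abs_nonneg _) (hbound _ x hx) 2)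
      (Filter.Eventually.of_forall fun x => (hpt x).pow 2)
    refine tendsto_nhds_unique h1 ?_
    simp_rw [hG1]
    exact tendsto_const_nhds
  have hpow : Continuous fun s : ℝ => |s| ^ (q - 1) * s :=
    (continuous_abs.rpow_const fun _ => Or.inr (by linarith)).mul continuous_id
  have hav : Filter.Tendsto (fun n => qAverage q (prim (G (φ n)))) Filter.atTop
      (nhds (qAverage q (prim g))) := by
    simp_rw [qAverage_eq]
    refine tendsto_integral_of_dominated_convergence (fun _ => √(2 * r 0) ^ (q - 1) * √(2 * r 0))
      (fun n => (hpow.comp (hG (φ n)).continuous_prim).aestronglyMeasurable) (integrable_const _)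
      (fun n => ae_vol_of_forall_Icc fun x hx => ?_)
      (Filter.Eventually.of_forall fun x => (hpow.tendsto _).comp (hpt x))
    rw [Real.norm_eq_abs, abs_mul, abs_of_nonneg (Real.rpow_nonneg (abs_nonneg _) _)]
    have := hbound (φ n) x hx
    exact mul_le_mul (Real.rpow_le_rpow (abs_nonneg _) this (by linarith)) this (abs_nonneg _)
      (by positivity)
  have hrpow : Continuous fun s : ℝ => |s| ^ (2 / q) :=
    continuous_abs.rpow_const fun _ => Or.inr (by positivity)
  -- weak lower semicontinuity of the Dirichlet integral
  have hlow : ∀ n, 2 * (∫ x, G (φ n) x * g x ∂vol) - (∫ x, g x ^ 2 ∂vol)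
      + α * |qAverage q (prim (G (φ n)))| ^ (2 / q) ≤ r (φ n) := by
    intro n
    have h1 := integral_add_mul_sq (hG (φ n)).1 hg (-1)
    have h2 : 0 ≤ ∫ x, (G (φ n) x + -1 * g x) ^ 2 ∂vol := integral_nonneg fun x => sq_nonneg _
    have h3 := hGN (φ n)
    simp only [hN] at h3
    rw [h3]
    linarith
  have hle : 2 * (∫ x, g x * g x ∂vol) - (∫ x, g x ^ 2 ∂vol)
      + α * |qAverage q (prim g)| ^ (2 / q) ≤ μ :=
    le_of_tendsto_of_tendsto' ((((hweak g hg).const_mul 2).sub_const _).add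
      (((hrpow.tendsto _).comp hav).const_mul α)) (hrlim.comp hφ.tendsto_atTop) hlow
  refine ⟨g, μ, hgm, hsq, le_antisymm ?_ (hmin g hgm), hmin⟩
  rw [hgap, hsq]
  simp only [hN]
  have : ∫ x, g x * g x ∂vol = ∫ x, g x ^ 2 ∂vol := by congr 1; funext x; ring
  linarith

end

/-! ### Minimizers and the saturation threshold -/

section

variable {α μ q : ℝ} {g : ℝ → ℝ}

theorem Admissible.meanZero {u u' : ℝ → ℝ} (h : Admissible u u') : MeanZero u' :=
  ⟨h.1.memLp_deriv, h.1.prim_deriv_one⟩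

theorem Admissible.prim_ne_zero {u u' : ℝ → ℝ} (h : Admissible u u') : ¬ prim u' =ᵐ[vol] 0 :=
  fun h0 => h.2 (h.1.ae_eq_prim.trans h0)

theorem admissible_prim (hg : MeanZero g) (h0 : ¬ prim g =ᵐ[vol] 0) : Admissible (prim g) g :=
  ⟨isH10_prim hg.1 hg.2, h0⟩

theorem rayleigh_eq {u u' : ℝ → ℝ} (h : u =ᵐ[vol] prim u') (α q : ℝ) :
    rayleigh α q u u' = ((∫ x, u' x ^ 2 ∂vol) + α * |qAverage q (prim u')| ^ (2 / q))
      / ∫ x, prim u' x ^ 2 ∂vol := by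
  rw [rayleigh, qAverage_congr h, integral_eq_integral_vol, integral_eq_integral_vol]
  simp_rw [sq_abs]
  congr 1
  apply integral_congr_ae
  filter_upwards [h] with x hx
  rw [hx]

theorem gap_eq (hg : MeanZero g) (h0 : ¬ prim g =ᵐ[vol] 0) (α q μ : ℝ) :
    gap α q μ g = (rayleigh α q (prim g) g - μ) * ∫ x, prim g x ^ 2 ∂vol := by
  have hD := integral_prim_sq_pos hg h0
  rw [rayleigh_eq Filter.EventuallyEq.rfl, gap]
  field_simp

theorem Admissible.rayleigh_eq_prim {u u' : ℝ → ℝ} (h : Admissible u u') (α q : ℝ) :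
    rayleigh α q u u' = rayleigh α q (prim u') u' := by
  rw [rayleigh_eq h.1.ae_eq_prim, rayleigh_eq Filter.EventuallyEq.rfl]

/-- `prim g` minimizes the quotient, with minimal value `μ`. -/
structure IsMinimal (α q μ : ℝ) (g : ℝ → ℝ) : Prop where
  meanZero : MeanZero g
  ne_zero : ¬ prim g =ᵐ[vol] 0
  gap_nonneg : ∀ h, MeanZero h → 0 ≤ gap α q μ h
  gap_eq_zero : gap α q μ g = 0

theorem isMinimal_of_rayleigh_le (hq : 1 ≤ q) {y y' : ℝ → ℝ} (hy : Admissible y y')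
    (hmin : ∀ u u', Admissible u u' → rayleigh α q y y' ≤ rayleigh α q u u') :
    IsMinimal α q (rayleigh α q y y') y' := by
  refine ⟨hy.meanZero, hy.prim_ne_zero, fun h hh => ?_, ?_⟩
  · by_cases h0 : prim h =ᵐ[vol] 0
    · exact gap_nonneg_of_prim_eq_zero hq h0
    · rw [gap_eq hh h0]
      have := hmin _ _ (admissible_prim hh h0)
      exact mul_nonneg (by linarith) (integral_nonneg fun x => sq_nonneg _)
  · rw [gap_eq hy.meanZero hy.prim_ne_zero, hy.rayleigh_eq_prim]
    ring

theorem IsMinimal.le_rayleigh (hg : IsMinimal α q μ g) {u u' : ℝ → ℝ} (hu : Admissible u u') :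
    μ ≤ rayleigh α q u u' := by
  have h1 := hg.gap_nonneg u' hu.meanZero
  rw [gap_eq hu.meanZero hu.prim_ne_zero] at h1
  have h2 := nonneg_of_mul_nonneg_left h1 (integral_prim_sq_pos hu.meanZero hu.prim_ne_zero)
  rw [hu.rayleigh_eq_prim]
  linarith

theorem exists_prim_ne_zero (h : ¬ prim g =ᵐ[vol] 0) : ∃ x ∈ Icc (-1 : ℝ) 1, prim g x ≠ 0 := by
  by_contra! hcon
  exact h (ae_vol_of_forall_Icc hcon)

theorem qAverage_congr_Icc {u v : ℝ → ℝ} (h : ∀ x ∈ Icc (-1 : ℝ) 1, u x = v x) :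
    qAverage q u = qAverage q v :=
  qAverage_congr (ae_vol_of_forall_Icc h)

/-- A minimizer with an interior zero has level at least `π²`. At level `π²` and with vanishing
`q`-average it is a multiple of the sine. -/
theorem IsMinimal.pi_sq_le (hq : 1 ≤ q) (hq2 : q ≤ 2) (hg : IsMinimal α q μ g) {d : ℝ}
    (hd : d ∈ Ioo (-1 : ℝ) 1) (hd0 : prim g d = 0) :
    Real.pi ^ 2 ≤ μ ∧ (μ = Real.pi ^ 2 → qAverage q (prim g) = 0 →
      ∃ c, ∀ x ∈ Icc (-1 : ℝ) 1, prim g x = c * Real.sin (Real.pi * x)) := by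
  obtain ⟨κ, y, v, hs, hy⟩ := exists_solvesOn hq hq2 hg.meanZero hg.gap_nonneg hg.gap_eq_zero
  have hl : y (-1) = 0 := by rw [hy _ (by simp), prim_neg_one]
  have hr : y 1 = 0 := by rw [hy _ (by simp), hg.meanZero.2]
  have hne : ∃ x ∈ Icc (-1 : ℝ) 1, y x ≠ 0 := by
    obtain ⟨x, hx, hx0⟩ := exists_prim_ne_zero hg.ne_zero
    exact ⟨x, hx, by rwa [hy x hx]⟩
  obtain ⟨h1, h2⟩ := hs.pi_sq_le hq hq2 hl hr hd
    (by rw [hy d (Ioo_subset_Icc_self hd), hd0]) hne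
  refine ⟨h1, fun hμ hav => ?_⟩
  have hκ := h2 hμ ((qAverage_congr_Icc hy).trans hav)
  subst hμ hκ
  obtain ⟨c, hc⟩ := hs.exists_eq_sin hl
  exact ⟨c, fun x hx => by rw [← hy x hx, hc x hx]⟩

theorem MeanZero.pos_or_neg (hg : MeanZero g) (h : ∀ x ∈ Ioo (-1 : ℝ) 1, prim g x ≠ 0) :
    (∀ x ∈ Ioo (-1 : ℝ) 1, 0 < prim g x) ∨ ∀ x ∈ Ioo (-1 : ℝ) 1, prim g x < 0 := by
  by_contra! hcon
  obtain ⟨⟨a, ha, ha0⟩, b, hb, hb0⟩ := hcon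
  obtain ⟨x, hx, hx0⟩ := isPreconnected_Ioo.intermediate_value ha hb
    hg.continuous_prim.continuousOn ⟨ha0, hb0⟩
  exact h x hx hx0

theorem abs_qAverage_eq_of_sign (hg : MeanZero g) (h : ∀ x ∈ Ioo (-1 : ℝ) 1, prim g x ≠ 0) :
    |qAverage q (prim g)| = ∫ x, |prim g x| ^ (q - 1) * |prim g x| ∂vol := by
  have hn : 0 ≤ ∫ x, |prim g x| ^ (q - 1) * |prim g x| ∂vol :=
    integral_nonneg fun x => by positivity
  have hae : ∀ p : ℝ → Prop, (∀ x ∈ Ioo (-1 : ℝ) 1, p x) → ∀ᵐ x ∂vol, p x := fun p hp => by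
    unfold vol
    filter_upwards [ae_restrict_mem measurableSet_Ioo] with x hx using hp x hx
  rw [qAverage_eq]
  rcases hg.pos_or_neg h with hs | hs
  · have : ∫ x, |prim g x| ^ (q - 1) * prim g x ∂vol
        = ∫ x, |prim g x| ^ (q - 1) * |prim g x| ∂vol := by
      apply integral_congr_ae
      exact hae _ fun x hx => by simp only [abs_of_pos (hs x hx)]
    rw [this, abs_of_nonneg hn]
  · have : ∫ x, |prim g x| ^ (q - 1) * prim g x ∂vol
        = -∫ x, |prim g x| ^ (q - 1) * |prim g x| ∂vol := by
      rw [← integral_neg]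
      apply integral_congr_ae
      exact hae _ fun x hx => by simp only [abs_of_neg (hs x hx)]; ring
    rw [this, abs_neg, abs_of_nonneg hn]

/-- The `q`-average of a function of constant sign controls its `L²` norm by interpolation against
the supremum norm, which is controlled by the Dirichlet integral. -/
theorem integral_sq_le_of_sign (hq : 1 ≤ q) (hq2 : q ≤ 2) (hg : MeanZero g)
    (h0 : ¬ prim g =ᵐ[vol] 0) (h : ∀ x ∈ Ioo (-1 : ℝ) 1, prim g x ≠ 0)
    (hle : ∫ x, g x ^ 2 ∂vol ≤ Real.pi ^ 2 * ∫ x, prim g x ^ 2 ∂vol) :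
    ∫ x, prim g x ^ 2 ∂vol ≤ 2 * Real.pi ^ 2 * |qAverage q (prim g)| ^ (2 / q) := by
  set D := ∫ x, prim g x ^ 2 ∂vol with hDdef
  have hD : 0 < D := integral_prim_sq_pos hg h0
  have hA := abs_qAverage_eq_of_sign (q := q) hg h
  set A := |qAverage q (prim g)| with hAdef
  have hA0 : 0 ≤ A := abs_nonneg _
  have hpi : 1 ≤ 2 * Real.pi ^ 2 := by nlinarith [Real.pi_gt_three]
  have hq0 : 0 < q := by linarith
  set b := 2 * Real.pi ^ 2 * D with hb
  have hb0 : 0 < b := by positivity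
  have hsup : ∀ x ∈ Icc (-1 : ℝ) 1, |prim g x| ≤ √b := fun x hx =>
    Real.abs_le_sqrt ((sq_prim_le hg.1 hx).trans (by rw [hb]; linarith))
  have hpowc : Continuous fun x => |prim g x| ^ (q - 1) * |prim g x| :=
    (hg.continuous_prim.abs.rpow_const fun _ => Or.inr (by linarith)).mul hg.continuous_prim.abs
  have h1 : D ≤ √b ^ (2 - q) * A := by
    rw [hA, ← integral_const_mul]
    refine integral_mono_ae (memLp_prim hg.integrable).integrable_sq
      ((integrable_of_continuous hpowc).const_mul _) (ae_vol_of_forall_Icc fun x hx => ?_)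
    have e : prim g x ^ 2 = |prim g x| ^ (2 - q) * (|prim g x| ^ (q - 1) * |prim g x|) := by
      rcases eq_or_ne (prim g x) 0 with hz | hz
      · simp [hz]
      · have hz' : 0 < |prim g x| := abs_pos.2 hz
        rw [← mul_assoc, ← Real.rpow_add hz', ← sq_abs, sq]
        norm_num
    simp only [e]
    exact mul_le_mul_of_nonneg_right
      (Real.rpow_le_rpow (abs_nonneg _) (hsup x hx) (by linarith)) (by positivity)
  -- raise to the power `r = 2 / q`
  set r := 2 / q with hr
  have hr1 : 0 ≤ r - 1 := by rw [hr, sub_nonneg, le_div_iff₀ hq0]; linarith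
  have hr2 : r - 1 ≤ 1 := by rw [hr, sub_le_iff_le_add, div_le_iff₀ hq0]; linarith
  have h2 : D ^ r ≤ b ^ (r - 1) * A ^ r := by
    refine (Real.rpow_le_rpow hD.le h1 (by linarith)).trans (le_of_eq ?_)
    rw [Real.mul_rpow (by positivity) hA0, ← Real.rpow_mul (Real.sqrt_nonneg _),
      Real.sqrt_eq_rpow, ← Real.rpow_mul hb0.le]
    congr 2
    rw [hr]; field_simp
  have h3 : b ^ (r - 1) = (2 * Real.pi ^ 2) ^ (r - 1) * D ^ (r - 1) :=
    Real.mul_rpow (by positivity) hD.le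
  have h4 : D ^ r = D * D ^ (r - 1) := by
    rw [Real.rpow_sub_one hD.ne']; field_simp
  have hDr : 0 < D ^ (r - 1) := Real.rpow_pos_of_pos hD _
  have h5 : D ≤ (2 * Real.pi ^ 2) ^ (r - 1) * A ^ r := by
    rw [h3, h4] at h2
    refine le_of_mul_le_mul_right ?_ hDr
    linarith
  refine h5.trans (mul_le_mul_of_nonneg_right ?_ (by positivity))
  calc (2 * Real.pi ^ 2) ^ (r - 1) ≤ (2 * Real.pi ^ 2) ^ (1 : ℝ) :=
        Real.rpow_le_rpow_of_exponent_le hpi hr2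
    _ = 2 * Real.pi ^ 2 := Real.rpow_one _

/-- The values of `α` for which the infimum is at least `π²`. -/
def saturated (q : ℝ) : Set ℝ :=
  {α | ∀ u u' : ℝ → ℝ, Admissible u u' → Real.pi ^ 2 ≤ rayleigh α q u u'}

/-- For this value of `α`, a minimizer below level `π²` would have constant sign by
`IsMinimal.pi_sq_le`, and then its `q`-average would be too large. -/
theorem two_mul_pi_pow_four_mem_saturated (hq : 1 ≤ q) (hq2 : q ≤ 2) :
    2 * Real.pi ^ 4 ∈ saturated q := by
  by_contra hcon
  simp only [saturated, mem_ofPred_eq, not_forall, not_le] at hcon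
  obtain ⟨u, u', hu, hlt⟩ := hcon
  have hα : 0 ≤ 2 * Real.pi ^ 4 := by positivity
  obtain ⟨g, μ, hg, hg1, hgap, hmin⟩ := exists_minimizer hq hα
    ⟨u', hu.meanZero, hu.prim_ne_zero⟩
  have hg0 : ¬ prim g =ᵐ[vol] 0 := by
    intro h0
    have : ∫ x, prim g x ^ 2 ∂vol = 0 := by
      rw [integral_eq_zero_of_ae]
      filter_upwards [h0] with x hx
      simp [hx]
    linarith
  have hm : IsMinimal (2 * Real.pi ^ 4) q μ g := ⟨hg, hg0, hmin, hgap⟩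
  have hμ : μ < Real.pi ^ 2 := (hm.le_rayleigh hu).trans_lt hlt
  have hnz : ∀ x ∈ Ioo (-1 : ℝ) 1, prim g x ≠ 0 := fun x hx hx0 =>
    absurd (hm.pi_sq_le hq hq2 hx hx0).1 (not_le.2 hμ)
  rw [gap, hg1] at hgap
  have hP : 0 ≤ |qAverage q (prim g)| ^ (2 / q) := by positivity
  have h1 := integral_sq_le_of_sign hq hq2 hg hg0 hnz (by
    rw [hg1]
    nlinarith [mul_nonneg hα hP])
  rw [hg1] at h1
  have h2 : 0 ≤ ∫ x, g x ^ 2 ∂vol := integral_nonneg fun x => sq_nonneg _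
  nlinarith [sq_nonneg Real.pi]

theorem rayleigh_add (α ε q : ℝ) (u u' : ℝ → ℝ) : rayleigh (α + ε) q u u'
    = rayleigh α q u u' + ε * (|qAverage q u| ^ (2 / q) / ∫ x in (-1 : ℝ)..1, |u x| ^ 2) := by
  rw [rayleigh, rayleigh]
  ring

theorem qAverage_term_nonneg (q : ℝ) (u : ℝ → ℝ) :
    0 ≤ |qAverage q u| ^ (2 / q) / ∫ x in (-1 : ℝ)..1, |u x| ^ 2 := by
  refine div_nonneg (by positivity) ?_
  exact intervalIntegral.integral_nonneg (by norm_num) fun x _ => by positivity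

/-- The saturated set is closed under limits from above, since the quotient is affine in `α`. -/
theorem mem_saturated_of_forall_lt {α : ℝ} (h : ∀ β, α < β → ∃ β' ∈ saturated q, β' ≤ β) :
    α ∈ saturated q := by
  intro u u' hu
  by_contra! hlt
  set K := |qAverage q u| ^ (2 / q) / ∫ x in (-1 : ℝ)..1, |u x| ^ 2 with hK
  have hK0 : 0 ≤ K := qAverage_term_nonneg q u
  set ε := (Real.pi ^ 2 - rayleigh α q u u') / (2 * (K + 1)) with hε
  have hε0 : 0 < ε := div_pos (by linarith) (by positivity)
  have hεe : ε * (2 * (K + 1)) = Real.pi ^ 2 - rayleigh α q u u' := by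
    rw [hε]; field_simp
  obtain ⟨β', hβ', hle⟩ := h (α + ε) (by linarith)
  have h1 := hβ' u u' hu
  have h2 := rayleigh_add β' (α + ε - β') q u u'
  rw [add_sub_cancel, rayleigh_add, ← hK] at h2
  have h3 : 0 ≤ (α + ε - β') * K := mul_nonneg (by linarith) hK0
  nlinarith

theorem meanZero_neg_two_mul : MeanZero (fun x => -2 * x) ∧
    ∀ x ∈ Icc (-1 : ℝ) 1, prim (fun x => -2 * x) x = 1 - x ^ 2 := by
  have h : ∀ x ∈ Icc (-1 : ℝ) 1, prim (fun x => -2 * x) x = 1 - x ^ 2 := by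
    intro x hx
    rw [prim_eq_intervalIntegral _ hx, intervalIntegral.integral_const_mul, integral_id]
    ring
  exact ⟨⟨memLp_of_continuous (by fun_prop) 2, by rw [h 1 (by simp)]; norm_num⟩, h⟩

/-- Comparison with `1 - x²` bounds the saturated set away from `0`. -/
theorem exists_pos_le_of_mem_saturated (q : ℝ) :
    ∃ ε : ℝ, 0 < ε ∧ ∀ α ∈ saturated q, ε ≤ α := by
  obtain ⟨hm, hprim⟩ := meanZero_neg_two_mul
  set g : ℝ → ℝ := fun x => -2 * x with hg
  have hD : ∫ x, prim g x ^ 2 ∂vol = 16 / 15 := by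
    have : ∫ x, prim g x ^ 2 ∂vol = ∫ x in (-1 : ℝ)..1, (1 - 2 * x ^ 2 + x ^ 4) := by
      rw [integral_eq_integral_vol]
      apply integral_congr_ae
      refine ae_vol_of_forall_Icc fun x hx => ?_
      simp only [hprim x hx]; ring
    rw [this, intervalIntegral.integral_add (Continuous.intervalIntegrable (by fun_prop) _ _)
        (Continuous.intervalIntegrable (by fun_prop) _ _),
      intervalIntegral.integral_sub (Continuous.intervalIntegrable (by fun_prop) _ _)
        (Continuous.intervalIntegrable (by fun_prop) _ _),
      intervalIntegral.integral_const_mul, integral_pow, integral_pow]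
    norm_num
  have hN : ∫ x, g x ^ 2 ∂vol = 8 / 3 := by
    have : ∫ x, g x ^ 2 ∂vol = ∫ x in (-1 : ℝ)..1, 4 * x ^ 2 := by
      rw [integral_eq_integral_vol]
      congr 1; funext x; simp only [hg]; ring
    rw [this, intervalIntegral.integral_const_mul, integral_pow]
    norm_num
  have h0 : ¬ prim g =ᵐ[vol] 0 := by
    intro h
    have : ∫ x, prim g x ^ 2 ∂vol = 0 := by
      rw [integral_eq_zero_of_ae]
      filter_upwards [h] with x hx
      simp [hx]
    rw [hD] at this
    norm_num at this
  set P := |qAverage q (prim g)| ^ (2 / q) with hP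
  have hP0 : 0 ≤ P := by positivity
  refine ⟨1 / (P + 1), by positivity, fun α hα => ?_⟩
  have h1 := hα _ _ (admissible_prim hm h0)
  rw [rayleigh_eq Filter.EventuallyEq.rfl, hN, hD, ← hP, le_div_iff₀ (by norm_num)] at h1
  have hpi : 9 < Real.pi ^ 2 := by nlinarith [Real.pi_gt_three]
  have h2 : 1 ≤ α * P := by linarith
  have hα0 : 0 < α := by
    by_contra! hle
    nlinarith
  rw [div_le_iff₀ (by positivity)]
  nlinarith

theorem hasDerivAt_sin_pi (c x : ℝ) : HasDerivAt (fun x => c * Real.sin (Real.pi * x))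
    (c * (Real.pi * Real.cos (Real.pi * x))) x := by
  have h : HasDerivAt (fun x => Real.pi * x) Real.pi x :=
    ((hasDerivAt_id x).const_mul Real.pi).congr_deriv (by simp)
  exact (h.sin.const_mul c).congr_deriv (by ring)

theorem prim_cos_pi (c : ℝ) : ∀ x ∈ Icc (-1 : ℝ) 1,
    prim (fun x => c * (Real.pi * Real.cos (Real.pi * x))) x = c * Real.sin (Real.pi * x) := by
  intro x hx
  have hc : Continuous fun x => c * (Real.pi * Real.cos (Real.pi * x)) := by fun_prop
  rw [prim_eq_intervalIntegral _ hx, intervalIntegral.integral_eq_sub_of_hasDerivAt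
    (fun t _ => hasDerivAt_sin_pi c t) (hc.intervalIntegrable _ _)]
  simp

theorem meanZero_cos_pi (c : ℝ) : MeanZero (fun x => c * (Real.pi * Real.cos (Real.pi * x))) :=
  ⟨memLp_of_continuous (by fun_prop) 2, by rw [prim_cos_pi c 1 (by simp)]; simp⟩

theorem integral_sin_pi_sq : ∫ x, Real.sin (Real.pi * x) ^ 2 ∂vol = 1 := by
  rw [← integral_eq_integral_vol,
    intervalIntegral.integral_comp_mul_left (fun x => Real.sin x ^ 2) Real.pi_ne_zero,
    integral_sin_sq]
  simp

theorem integral_cos_pi_sq : ∫ x, Real.cos (Real.pi * x) ^ 2 ∂vol = 1 := by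
  rw [← integral_eq_integral_vol,
    intervalIntegral.integral_comp_mul_left (fun x => Real.cos x ^ 2) Real.pi_ne_zero,
    integral_cos_sq]
  simp

theorem qAverage_sin (q c : ℝ) : qAverage q (fun x => c * Real.sin (Real.pi * x)) = 0 := by
  have h := intervalIntegral.integral_comp_neg
    (fun x => |c * Real.sin (Real.pi * x)| ^ (q - 1) * (c * Real.sin (Real.pi * x)))
    (a := -1) (b := 1)
  rw [neg_neg] at h
  have h2 : ∫ x in (-1 : ℝ)..1, |c * Real.sin (Real.pi * -x)| ^ (q - 1)
      * (c * Real.sin (Real.pi * -x))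
      = -∫ x in (-1 : ℝ)..1, |c * Real.sin (Real.pi * x)| ^ (q - 1)
        * (c * Real.sin (Real.pi * x)) := by
    rw [← intervalIntegral.integral_neg]
    congr 1; funext x
    rw [mul_neg, Real.sin_neg, mul_neg, abs_neg]; ring
  rw [h2] at h
  rw [qAverage]
  linarith

theorem admissible_sin {c : ℝ} (hc : c ≠ 0) :
    Admissible (fun x => c * Real.sin (Real.pi * x))
      (fun x => c * (Real.pi * Real.cos (Real.pi * x))) := by
  have hae := ae_vol_of_forall_Icc (prim_cos_pi c)
  refine ⟨(isH10_prim (meanZero_cos_pi c).1 (meanZero_cos_pi c).2).congr hae, fun h0 => ?_⟩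
  have : ∫ x, (c * Real.sin (Real.pi * x)) ^ 2 ∂vol = 0 := by
    rw [integral_eq_zero_of_ae]
    filter_upwards [h0] with x hx
    simp only [Pi.zero_apply] at hx
    simp [hx]
  simp_rw [mul_pow] at this
  rw [integral_const_mul, integral_sin_pi_sq] at this
  simp [hc] at this

theorem rayleigh_sin (hq : 1 ≤ q) {c : ℝ} (hc : c ≠ 0) (α : ℝ) :
    rayleigh α q (fun x => c * Real.sin (Real.pi * x))
      (fun x => c * (Real.pi * Real.cos (Real.pi * x))) = Real.pi ^ 2 := by
  have h3 : (2 / q : ℝ) ≠ 0 := by positivity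
  rw [rayleigh, qAverage_sin, integral_eq_integral_vol, integral_eq_integral_vol, abs_zero,
    Real.zero_rpow h3]
  simp_rw [sq_abs, mul_pow]
  rw [integral_const_mul, integral_const_mul, integral_const_mul, integral_sin_pi_sq,
    integral_cos_pi_sq]
  field_simp
  ring

theorem rayleigh_congr {u v u' : ℝ → ℝ} (h : u =ᵐ[vol] v) (α q : ℝ) :
    rayleigh α q u u' = rayleigh α q v u' := by
  rw [rayleigh, rayleigh, qAverage_congr h]
  congr 1
  rw [integral_eq_integral_vol, integral_eq_integral_vol]
  apply integral_congr_ae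
  filter_upwards [h] with x hx
  rw [hx]

theorem lam_eq_of_mem_saturated (hq : 1 ≤ q) (hα : α ∈ saturated q) : lam α q = Real.pi ^ 2 := by
  have hsin := rayleigh_sin hq one_ne_zero α
  have hadm := admissible_sin one_ne_zero
  refine le_antisymm ?_ ?_
  · refine csInf_le ⟨Real.pi ^ 2, ?_⟩ ⟨_, _, hadm, hsin.symm⟩
    rintro r ⟨u, u', hu, rfl⟩
    exact hα u u' hu
  · refine le_csInf ⟨_, _, _, hadm, hsin.symm⟩ ?_
    rintro r ⟨u, u', hu, rfl⟩
    exact hα u u' hu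

/-- If the quotients were unbounded below, `lam` would take the junk value `0`, which is less than `π²`
as well. -/
theorem lam_lt_of_notMem_saturated (hα : α ∉ saturated q) : lam α q < Real.pi ^ 2 := by
  simp only [saturated, mem_ofPred_eq, not_forall, not_le] at hα
  obtain ⟨u, u', hu, hlt⟩ := hα
  by_cases hb : BddBelow {r : ℝ | ∃ u u' : ℝ → ℝ, Admissible u u' ∧ r = rayleigh α q u u'}
  · exact (csInf_le hb ⟨u, u', hu, rfl⟩).trans_lt hlt
  · rw [lam, Real.sInf_of_not_bddBelow hb]
    positivity

theorem hasConstantSign_of_notMem_saturated (hq : 1 ≤ q) (hq2 : q ≤ 2) (hα : α ∉ saturated q)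
    {y : ℝ → ℝ} (hy : IsMinimizer α q y) : HasConstantSign y := by
  obtain ⟨y', hadm, hmin⟩ := hy
  simp only [saturated, mem_ofPred_eq, not_forall, not_le] at hα
  obtain ⟨u, u', hu, hlt⟩ := hα
  have hm := isMinimal_of_rayleigh_le hq hadm hmin
  have hμ := (hmin u u' hu).trans_lt hlt
  exact ⟨prim y', hm.meanZero.continuous_prim.continuousOn, hadm.1.ae_eq_prim,
    hm.meanZero.pos_or_neg fun x hx hx0 =>
      absurd (hm.pi_sq_le hq hq2 hx hx0).1 (not_le.2 hμ)⟩

/-- Strictly above another saturated value, only the multiples of the sine are minimizers. -/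
theorem isMinimizer_iff_of_lt (hq : 1 ≤ q) (hq2 : q ≤ 2) {α' : ℝ} (hα' : α' ∈ saturated q)
    (hlt : α' < α) (hα : α ∈ saturated q) (y : ℝ → ℝ) :
    IsMinimizer α q y ↔ ∃ c : ℝ, c ≠ 0 ∧ y =ᵐ[vol] fun x => c * Real.sin (Real.pi * x) := by
  constructor
  · rintro ⟨y', hadm, hmin⟩
    have hm := isMinimal_of_rayleigh_le hq hadm hmin
    have hμ : rayleigh α q y y' = Real.pi ^ 2 := by
      refine le_antisymm ?_ (hα y y' hadm)
      rw [← rayleigh_sin hq one_ne_zero α]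
      exact hmin _ _ (admissible_sin one_ne_zero)
    -- a nonzero `q`-average would bring the quotient below `π²` for a slightly smaller `α`
    have hav : qAverage q (prim y') = 0 := by
      by_contra hne
      have h1 := hα' y y' hadm
      have h2 := rayleigh_add α' (α - α') q y y'
      rw [add_sub_cancel, hμ, hadm.rayleigh_eq_prim] at h2
      rw [hadm.rayleigh_eq_prim] at h1
      have hD : 0 < ∫ x in (-1 : ℝ)..1, |y x| ^ 2 := by
        have h3 := integral_prim_sq_pos hm.meanZero hm.ne_zero
        refine h3.trans_eq ?_
        rw [integral_eq_integral_vol]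
        apply integral_congr_ae
        filter_upwards [hadm.1.ae_eq_prim] with x hx
        rw [hx, sq_abs]
      rw [qAverage_congr hadm.1.ae_eq_prim] at h2
      have h4 : 0 < |qAverage q (prim y')| ^ (2 / q) := Real.rpow_pos_of_pos (abs_pos.2 hne) _
      have h5 := mul_pos (sub_pos.2 hlt) (div_pos h4 hD)
      linarith
    have hzero : ∃ d ∈ Ioo (-1 : ℝ) 1, prim y' d = 0 := by
      by_contra! hcon
      have h2 := integral_sq_le_of_sign hq hq2 hm.meanZero hm.ne_zero hcon (by
        have h3 := hm.gap_eq_zero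
        rw [gap, hav, abs_zero, Real.zero_rpow (by positivity), hμ] at h3
        linarith)
      rw [hav, abs_zero, Real.zero_rpow (by positivity), mul_zero] at h2
      exact absurd (integral_prim_sq_pos hm.meanZero hm.ne_zero) (not_lt.2 h2)
    obtain ⟨d, hd, hd0⟩ := hzero
    obtain ⟨c, hc⟩ := (hm.pi_sq_le hq hq2 hd hd0).2 hμ hav
    refine ⟨c, ?_, hadm.1.ae_eq_prim.trans (ae_vol_of_forall_Icc hc)⟩
    rintro rfl
    exact hm.ne_zero (ae_vol_of_forall_Icc fun x hx => by simp [hc x hx])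
  · rintro ⟨c, hc, hy⟩
    have hadm := admissible_sin hc
    refine ⟨fun x => c * (Real.pi * Real.cos (Real.pi * x)),
      ⟨hadm.1.congr hy.symm, fun h0 => hadm.2 (hy.symm.trans h0)⟩, fun u u' hu => ?_⟩
    rw [rayleigh_congr hy, rayleigh_sin hq hc]
    exact hα u u' hu

theorem sin_pi_mul_eq_zero_iff {x : ℝ} (hx : x ∈ Ioo (-1 : ℝ) 1) :
    Real.sin (Real.pi * x) = 0 ↔ x = 0 := by
  rw [Real.sin_eq_zero_iff_of_lt_of_lt (by nlinarith [Real.pi_pos, hx.1])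
    (by nlinarith [Real.pi_pos, hx.2])]
  simp [Real.pi_ne_zero]

end

end NonlocalEigenvalue

end

theorem theorem1p1 (q : ℝ) (hq1 : 1 ≤ q) (hq2 : q ≤ 2) :
    ∃ αq : ℝ, 0 < αq ∧
      (∀ α : ℝ, α < αq →
        NonlocalEigenvalue.lam α q < Real.pi ^ 2 ∧
        ∀ y : ℝ → ℝ, NonlocalEigenvalue.IsMinimizer α q y →
          NonlocalEigenvalue.HasConstantSign y) ∧
      (∀ α : ℝ, αq ≤ α → NonlocalEigenvalue.lam α q = Real.pi ^ 2) ∧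
      (∀ α : ℝ, αq < α →
        ∀ y : ℝ → ℝ, NonlocalEigenvalue.IsMinimizer α q y ↔
          ∃ c : ℝ, c ≠ 0 ∧ y =ᵐ[NonlocalEigenvalue.vol] fun x => c * Real.sin (Real.pi * x)) ∧
      Function.Odd (fun x : ℝ => Real.sin (Real.pi * x)) ∧
      NonlocalEigenvalue.qAverage q (fun x => Real.sin (Real.pi * x)) = 0 ∧
      (∀ x ∈ Set.Ioo (-1 : ℝ) 1, Real.sin (Real.pi * x) = 0 ↔ x = 0) := by
  open NonlocalEigenvalue in
  obtain ⟨ε, hε, hbelow⟩ := exists_pos_le_of_mem_saturated q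
  have hne : (saturated q).Nonempty := ⟨_, two_mul_pi_pow_four_mem_saturated hq1 hq2⟩
  have hbdd : BddBelow (saturated q) := ⟨ε, hbelow⟩
  have hmem : ∀ α, sInf (saturated q) ≤ α → α ∈ saturated q := fun α hα =>
    mem_saturated_of_forall_lt fun β hβ => by
      obtain ⟨β', hβ', hlt⟩ := exists_lt_of_csInf_lt hne (hα.trans_lt hβ)
      exact ⟨β', hβ', hlt.le⟩
  refine ⟨sInf (saturated q), hε.trans_le (le_csInf hne hbelow), fun α hα => ?_, fun α hα => ?_,
    fun α hα y => ?_, fun x => ?_, ?_, fun x hx => sin_pi_mul_eq_zero_iff hx⟩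
  · have hα' : α ∉ saturated q := fun h => absurd (csInf_le hbdd h) (not_le.2 hα)
    exact ⟨lam_lt_of_notMem_saturated hα',
      fun y hy => hasConstantSign_of_notMem_saturated hq1 hq2 hα' hy⟩
  · exact lam_eq_of_mem_saturated hq1 (hmem α hα)
  · exact isMinimizer_iff_of_lt hq1 hq2 (hmem _ le_rfl) hα (hmem α hα.le) y
  · simp
  · simpa using qAverage_sin q 1
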